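/- Let $d\ge 2$, let $D\subset\mathbb{R}^d$ be a bounded open set (not necessarily connected) with $\partial D\in C^2$, and let $v\in L^\infty(D)$ be a real-valued potential. For $\alpha,E\in\mathbb{R}$ we say that $E$ is an eigenvalue of the operator $-\Delta+v$ in $D$ with the boundary condition $$\cos\alpha\,\psi|_{\partial D}-\sin\alpha\,\frac{\partial\psi}{\partial\nu}\Big|_{\partial D}=0 ,$$ where $\nu$ is the outward normal to $\partial D$, if there is a complex-valued function $\psi\in H^1(D)$, not almost everywhere zero, with $\Delta\psi\in L^2(D)$ in the sense of distributions, such that $-\Delta\psi+v\psi=E\psi$ almost everywhere in $D$ and such that the trace $\psi|_{\partial D}\in L^2(\partial D)$ and the normal derivative $\frac{\partial\psi}{\partial\nu}|_{\partial D}\in L^2(\partial D)$ satisfy the boundary condition almost everywhere on $\partial D$. Here the normal derivative is understood in the usual weak sense, as the function $h\in L^2(\partial D)$ with $$\int_D\big(\nabla\psi\cdot\nabla\varphi+(\Delta\psi)\,\varphi\big)\,dx=\int_{\partial D}h\,\varphi\,dS\qquad\text{for all }\varphi\in C_c^\infty(\mathbb{R}^d).$$ Then, for every fixed $E\in\mathbb{R}$,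 the set of all $\alpha\in\mathbb{R}$ for which $E$ is an eigenvalue of $-\Delta+v$ in $D$ with this boundary condition is at most countable. -/

import Mathlib

open MeasureTheory Filter
open scoped Topology ContDiff ENNReal

noncomputable section

namespace Impedance

/-- Euclidean space `ℝ^d`. -/
abbrev Space (d : ℕ) : Type := EuclideanSpace ℝ (Fin d)

/-- The classical partial derivative `∂φ/∂x_i`. -/
def partialDeriv {d : ℕ} (φ : Space d → ℂ) (i : Fin d) (x : Space d) : ℂ :=
  fderiv ℝ φ x (EuclideanSpace.single i 1)

/-- The boundary of `D` is of class `C²`, with `D` lying locally on one side of it: near each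
boundary point, `D` is the sublevel set `{ρ < 0}` of a `C²` function with nonzero differential. -/
def HasC2Boundary {d : ℕ} (D : Set (Space d)) : Prop :=
  ∀ p ∈ frontier D, ∃ (U : Set (Space d)) (ρ : Space d → ℝ),
    IsOpen U ∧ p ∈ U ∧ ContDiffOn ℝ 2 ρ U ∧ fderiv ℝ ρ p ≠ 0 ∧
      ∀ x ∈ U, (x ∈ D ↔ ρ x < 0)

/-- Lebesgue measure on `D`. -/
def volumeOn {d : ℕ} (D : Set (Space d)) : Measure (Space d) :=
  volume.restrict D

/-- Surface measure on `∂D`: the `(d-1)`-dimensional Hausdorff measure, normalised so that it is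
Lebesgue measure on hyperplanes. -/
def surfaceMeasure {d : ℕ} (D : Set (Space d)) : Measure (Space d) :=
  (Measure.euclideanHausdorffMeasure (d - 1)).restrict (frontier D)

/-- `φ ∈ C_c^∞(ℝ^d)`. -/
def IsTestFunction {d : ℕ} (φ : Space d → ℂ) : Prop :=
  ContDiff ℝ ∞ φ ∧ HasCompactSupport φ

/-- `ψ ∈ H¹(D)`, with weak (distributional) partial derivatives `G 1, …, G d` in `L²(D)`. -/
structure IsSobolevWithGradient {d : ℕ} (D : Set (Space d)) (ψ : Space d → ℂ)
    (G : Fin d → Space d → ℂ) : Prop where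
  memLp : MemLp ψ 2 (volumeOn D)
  memLp_grad : ∀ i, MemLp (G i) 2 (volumeOn D)
  weak_deriv : ∀ (i : Fin d) (φ : Space d → ℂ), IsTestFunction φ → tsupport φ ⊆ D →
    ∫ x, ψ x * partialDeriv φ i x ∂(volumeOn D) = - ∫ x, G i x * φ x ∂(volumeOn D)

/-- `g ∈ L²(∂D)` is the trace `ψ|_{∂D}` of the function `ψ ∈ H¹(D)` with weak gradient `G`: some
sequence of functions smooth up to the boundary tends to `ψ` in `H¹(D)`, while its restrictions to
`∂D` tend to `g` in `L²(∂D)`. -/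
structure IsTrace {d : ℕ} (D : Set (Space d)) (ψ : Space d → ℂ) (G : Fin d → Space d → ℂ)
    (g : Space d → ℂ) : Prop where
  memLp : MemLp g 2 (surfaceMeasure D)
  approx : ∃ u : ℕ → Space d → ℂ,
    (∀ n, ContDiff ℝ ∞ (u n)) ∧
    Tendsto (fun n => eLpNorm (fun x => u n x - ψ x) 2 (volumeOn D)) atTop (𝓝 0) ∧
    (∀ i, Tendsto (fun n => eLpNorm (fun x => partialDeriv (u n) i x - G i x) 2 (volumeOn D))
      atTop (𝓝 0)) ∧
    Tendsto (fun n => eLpNorm (fun x => u n x - g x) 2 (surfaceMeasure D)) atTop (𝓝 0)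

/-- `f ∈ L²(D)` is the distributional Laplacian on `D` of a function with weak gradient `G`. -/
structure IsWeakLaplacian {d : ℕ} (D : Set (Space d)) (G : Fin d → Space d → ℂ)
    (f : Space d → ℂ) : Prop where
  memLp : MemLp f 2 (volumeOn D)
  weak_div : ∀ φ : Space d → ℂ, IsTestFunction φ → tsupport φ ⊆ D →
    ∫ x, ∑ i, G i x * partialDeriv φ i x ∂(volumeOn D) = - ∫ x, f x * φ x ∂(volumeOn D)

/-- `h ∈ L²(∂D)` is the outward normal derivative on `∂D` (that is, the normal trace of the
gradient) of a function with weak gradient `G` and distributional Laplacian `f` on `D`: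
`∫_D (∇ψ · ∇φ + (Δψ) φ) dx = ∫_{∂D} (∂ψ/∂ν) φ dS` for all `φ ∈ C_c^∞(ℝ^d)`. -/
structure IsNormalDerivative {d : ℕ} (D : Set (Space d)) (G : Fin d → Space d → ℂ)
    (f h : Space d → ℂ) : Prop where
  memLp : MemLp h 2 (surfaceMeasure D)
  green : ∀ φ : Space d → ℂ, IsTestFunction φ →
    ∫ x, ((∑ i, G i x * partialDeriv φ i x) + f x * φ x) ∂(volumeOn D) =
      ∫ x, h x * φ x ∂(surfaceMeasure D)

/-- `E` is an eigenvalue of `-Δ + v` in `D` with the boundary condition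
`cos α ψ - sin α ∂ψ/∂ν = 0` on `∂D`: there is an eigenfunction `ψ`, not almost everywhere zero,
in `H¹(D)` with `Δψ ∈ L²(D)`, with `-Δψ + vψ = Eψ` in `D` and with the boundary condition holding
for the trace `g` and the normal derivative `h` of `ψ`. -/
def IsEigenvalue {d : ℕ} (D : Set (Space d)) (v : Space d → ℝ) (α E : ℝ) : Prop :=
  ∃ (ψ : Space d → ℂ) (G : Fin d → Space d → ℂ) (f g h : Space d → ℂ),
    ¬ (ψ =ᵐ[volumeOn D] 0) ∧
    IsSobolevWithGradient D ψ G ∧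
    IsWeakLaplacian D G f ∧
    IsTrace D ψ G g ∧
    IsNormalDerivative D G f h ∧
    (∀ᵐ x ∂(volumeOn D), - f x + (v x : ℂ) * ψ x = (E : ℂ) * ψ x) ∧
    (∀ᵐ x ∂(surfaceMeasure D),
      (Real.cos α : ℂ) * g x - (Real.sin α : ℂ) * h x = 0)

end Impedance

end

/-!
Why only countably many boundary conditions admit a given eigenvalue.

The boundary condition says that the Cauchy data `(g, h)` of an eigenfunction are of the form
`(sin α • k, cos α • k)` with `k = sin α • g + cos α • h` in `L²(∂D)`
(`IsSolution.ae_eq_boundaryDatum`). Green's second formula for the eigenfunctions that belong to `α`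
and `β`, the first one conjugated, reads `sin (α - β) * ∫ conj k_α * k_β = 0`, because the potential
is real and the energy is the same. So the data of angles that differ modulo `π` are orthogonal
(`IsSolution.integral_conj_boundaryDatum_mul`). As `L²(∂D)` is separable, only countably many of
them are nonzero; it remains to see that `k = 0` forces `ψ = 0`
(`IsSolution.ae_eq_zero_of_boundaryDatum`). This has two parts.

* If the trace and the normal derivative vanish, then the extension of `ψ` by zero is a weak solution
  on the whole space. The point is that a function of zero trace can be integrated by parts without
  boundary terms (`integral_mul_partialDeriv_of_trace_zero`). Approximation by smooth functions
  reduces this to the inequality `|∫_D ∂_i w| ≤ C ∫_{∂D} |w| dS` (`enorm_setIntegral_fderiv_le`),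
  which holds for every bounded open set with a boundary of finite surface measure and needs no
  divergence theorem: cover `∂D` efficiently by small balls, as in the definition of the Hausdorff
  measure, and remove the balls with a smooth cutoff `1 - θ`. The integral of `∂_i ((1 - θ) w)` over
  `D` is zero, while `θ ∂_i w` and `w ∂_i θ` contribute at most a constant times
  `∑ r_j ^ (d - 1) (r_j sup |∂_i w| + sup_{B_j} |w|)`. The smoothness of `∂D` only serves to show
  that the surface measure is finite (`hausdorffMeasure_frontier_ne_top`).

* A compactly supported weak solution of `Δψ = f` on the whole space with `|f| ≤ M |ψ|` is zero
  (`ae_eq_zero_of_weak_laplacian_le`). Testing with `exp (ζ · x)` gives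
  `(ζ · ζ) ∫ exp (ζ · x) ψ = ∫ exp (ζ · x) f`. Take `ζ = τ e₁ - i ξ` with `ξ` in the lattice dual to a
  cube of side `ℓ`, shifted by half a period in the first direction. Then `|ζ · ζ| ≥ 2 τ |ξ₁| ≥ 2πτ/ℓ`,
  and Parseval's identity on the cube bounds the norm of `exp (τ x₁) ψ` by `M ℓ / (2πτ)` times
  itself, which is absurd for large `τ` unless `ψ = 0`.
-/

namespace Impedance

open Metric Set
open scoped NNReal ComplexConjugate

/-! ### Efficient covers and cutoffs -/

/-- Sets of small `m`-dimensional Hausdorff measure have efficient covers by small balls that are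
centred in the set. -/
theorem exists_ball_cover {X : Type*} [MetricSpace X] [MeasurableSpace X] [BorelSpace X]
    [Nonempty X] {m : ℕ} (hm : 0 < m) (A : Set X) {a : ℝ≥0∞} (ha : Measure.hausdorffMeasure m A < a)
    {δ : ℝ} (hδ : 0 < δ) :
    ∃ (I : Set ℕ) (c : ℕ → X) (r : ℕ → ℝ), (∀ n, 0 < r n ∧ r n ≤ δ) ∧ (∀ n ∈ I, c n ∈ A) ∧
      A ⊆ ⋃ n ∈ I, ball (c n) (r n) ∧ ∑' n, ENNReal.ofReal (r n) ^ m ≤ a := by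
  classical
  rw [Measure.hausdorffMeasure_apply] at ha
  have h1 := (le_iSup₂_of_le (f := fun (r : ℝ≥0∞) (_ : 0 < r) =>
        ⨅ (t : ℕ → Set X) (_ : A ⊆ ⋃ n, t n) (_ : ∀ n, ediam (t n) ≤ r),
          ∑' n, ⨆ _ : (t n).Nonempty, ediam (t n) ^ (m : ℝ)) (ENNReal.ofReal (δ / 2))
          (by simpa using hδ) le_rfl).trans_lt ha
  simp only [iInf_lt_iff] at h1
  obtain ⟨t, hAt, htd, hS⟩ := h1
  set S := ∑' n, ⨆ _ : (t n).Nonempty, ediam (t n) ^ (m : ℝ) with hSdef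
  obtain ⟨ε, hε, hεS⟩ := ENNReal.exists_pos_sum_of_countable (ε := a - S)
    (tsub_pos_of_lt hS).ne' ℕ
  have hterm : ∀ n, ediam (t n) ^ m ≤ ⨆ _ : (t n).Nonempty, ediam (t n) ^ (m : ℝ) := by
    intro n
    rcases (t n).eq_empty_or_nonempty with h | h
    · simp [h, hm.ne']
    · simp [h]
  have hfin : ∀ n, ediam (t n) ≠ ⊤ := fun n => ((htd n).trans_lt ENNReal.ofReal_lt_top).ne
  have hdiam : ∀ n, (ediam (t n)).toReal ≤ δ / 2 := fun n =>
    ENNReal.toReal_le_of_le_ofReal (by positivity) (htd n)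
  have hr : ∀ n, ∃ r : ℝ, (ediam (t n)).toReal < r ∧ r ≤ δ ∧
      ENNReal.ofReal r ^ m ≤ ediam (t n) ^ m + ε n := by
    intro n
    have hlt : ediam (t n) ^ m < ediam (t n) ^ m + ε n :=
      ENNReal.lt_add_right (ENNReal.pow_ne_top (hfin n)) (by simpa using (hε n).ne')
    have hcont : Tendsto (fun r : ℝ => ENNReal.ofReal r ^ m) (𝓝[>] (ediam (t n)).toReal)
        (𝓝 (ediam (t n) ^ m)) := by
      have : ContinuousAt (fun r : ℝ => ENNReal.ofReal r ^ m) (ediam (t n)).toReal :=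
        ((ENNReal.continuous_pow m).comp ENNReal.continuous_ofReal).continuousAt
      have h2 := this.tendsto
      rw [ENNReal.ofReal_toReal (hfin n)] at h2
      exact h2.mono_left nhdsWithin_le_nhds
    have h3 := hcont.eventually (gt_mem_nhds hlt)
    have h4 : ∀ᶠ r in 𝓝[>] (ediam (t n)).toReal, r < δ :=
      (eventually_nhdsWithin_of_eventually_nhds
        (gt_mem_nhds (by have := hdiam n; linarith)))
    obtain ⟨r, hr1, hr2, hr3⟩ := (h3.and (h4.and self_mem_nhdsWithin)).exists
    exact ⟨r, hr3, hr2.le, hr1.le⟩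
  choose r hr1 hr2 hr3 using hr
  have hc : ∀ n, ∃ c : X, (t n ∩ A).Nonempty → c ∈ t n ∩ A := by
    intro n
    by_cases h : (t n ∩ A).Nonempty
    · exact ⟨h.some, fun _ => h.some_mem⟩
    · exact ⟨Classical.arbitrary X, fun h' => absurd h' h⟩
  choose c hc using hc
  refine ⟨{n | (t n ∩ A).Nonempty}, c, r, fun n => ⟨ENNReal.toReal_nonneg.trans_lt (hr1 n), hr2 n⟩,
    fun n hn => (hc n hn).2, ?_, ?_⟩
  · intro x hx
    obtain ⟨n, hn⟩ := mem_iUnion.1 (hAt hx)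
    have hne : (t n ∩ A).Nonempty := ⟨x, hn, hx⟩
    refine mem_iUnion₂.2 ⟨n, hne, ?_⟩
    have h5 : edist x (c n) ≤ ediam (t n) := edist_le_ediam_of_mem hn (hc n hne).1
    rw [mem_ball, dist_edist]
    exact (ENNReal.toReal_mono (hfin n) h5).trans_lt (hr1 n)
  · calc ∑' n, ENNReal.ofReal (r n) ^ m
        ≤ ∑' n, ((⨆ _ : (t n).Nonempty, ediam (t n) ^ (m : ℝ)) + ε n) :=
          ENNReal.tsum_le_tsum fun n => (hr3 n).trans (by gcongr; exact hterm n)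
      _ = S + ∑' n, (ε n : ℝ≥0∞) := ENNReal.tsum_add
      _ ≤ S + (a - S) := by gcongr
      _ = a := add_tsub_cancel_of_le hS.le

/-- The derivative of a compactly supported function integrates to zero. -/
theorem integral_fderiv_apply_eq_zero {E : Type*} [NormedAddCommGroup E] [NormedSpace ℝ E]
    [FiniteDimensional ℝ E] [MeasurableSpace E] [BorelSpace E] (μ : Measure E)
    [μ.IsAddHaarMeasure] {w : E → ℂ} (hw : ContDiff ℝ 1 w) (hc : HasCompactSupport w) (e : E) :
    ∫ x, fderiv ℝ w x e ∂μ = 0 := by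
  have h := integral_mul_fderiv_eq_neg_fderiv_mul_of_integrable (μ := μ) (f := fun _ : E => (1 : ℂ))
    (g := w) (v := e) (by simp) ?_ ?_ (fun x _ => differentiableAt_const _)
    (fun x _ => (hw.differentiable one_ne_zero) x)
  · simpa using h
  · simp only [one_mul]
    refine Continuous.integrable_of_hasCompactSupport ?_ (hc.fderiv_apply (𝕜 := ℝ) e)
    exact (hw.continuous_fderiv one_ne_zero).clm_apply continuous_const
  · simpa using hw.continuous.integrable_of_hasCompactSupport hc

/-- Smooth bumps at all places and scales: the gradient of a bump of radius `r` is at most `L / r`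
with a constant `L` that depends only on the space. -/
theorem exists_bump (E : Type*) [NormedAddCommGroup E] [NormedSpace ℝ E] [FiniteDimensional ℝ E] :
    ∃ L : ℝ, 0 ≤ L ∧ ∀ (c : E) (r : ℝ), 0 < r → ∃ χ : E → ℝ, ContDiff ℝ ∞ χ ∧
      (∀ x, 0 ≤ χ x ∧ χ x ≤ 1) ∧ (∀ x ∈ ball c r, χ x = 1) ∧
      (∀ x, χ x ≤ (closedBall c (2 * r)).indicator 1 x) ∧
      (∀ x, ‖fderiv ℝ χ x‖ ≤ (closedBall c (2 * r)).indicator (fun _ => L / r) x) := by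
  let b : ContDiffBump (0 : E) := ⟨1, 2, one_pos, one_lt_two⟩
  have hb : ContDiff ℝ ∞ b := b.contDiff
  obtain ⟨L, hL⟩ := (b.hasCompactSupport.fderiv ℝ).exists_bound_of_continuous
    (hb.continuous_fderiv (by simp))
  have hL0 : 0 ≤ L := (norm_nonneg _).trans (hL 0)
  refine ⟨L, hL0, fun c r hr => ⟨fun x => b (r⁻¹ • (x - c)), ?_, ?_, ?_, ?_, ?_⟩⟩
  · exact hb.comp (by fun_prop)
  · exact fun x => ⟨b.nonneg, b.le_one⟩
  · intro x hx
    apply b.one_of_mem_closedBall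
    rw [mem_closedBall, dist_zero_right, norm_smul, norm_inv, Real.norm_of_nonneg hr.le,
      inv_mul_le_one₀ hr, ← dist_eq_norm]
    exact (mem_ball.1 hx).le
  · intro x
    by_cases hx : x ∈ closedBall c (2 * r)
    · simpa [hx] using b.le_one
    · rw [indicator_of_notMem hx]
      apply le_of_eq
      apply b.zero_of_le_dist
      rw [dist_zero_right, norm_smul, norm_inv, Real.norm_of_nonneg hr.le, ← dist_eq_norm,
        le_inv_mul_iff₀ hr, mul_comm]
      exact (not_le.1 (mem_closedBall.not.1 hx)).le
  · intro x
    have hder : HasFDerivAt (fun x => b (r⁻¹ • (x - c)))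
        ((fderiv ℝ b (r⁻¹ • (x - c))).comp (r⁻¹ • ContinuousLinearMap.id ℝ E)) x := by
      refine HasFDerivAt.comp (g := (b : E → ℝ)) (f := fun x => r⁻¹ • (x - c)) x
        ((hb.differentiable (by simp)) _).hasFDerivAt ?_
      exact ((hasFDerivAt_id x).sub_const c).const_smul r⁻¹
    by_cases hx : x ∈ closedBall c (2 * r)
    · rw [indicator_of_mem hx, hder.fderiv, ContinuousLinearMap.comp_smul,
        ContinuousLinearMap.comp_id, norm_smul, norm_inv, Real.norm_of_nonneg hr.le, div_eq_inv_mul]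
      gcongr
      exact hL _
    · rw [indicator_of_notMem hx]
      apply le_of_eq
      rw [norm_eq_zero]
      have : (fun x => b (r⁻¹ • (x - c))) =ᶠ[𝓝 x] fun _ => (0 : ℝ) := by
        filter_upwards [isClosed_closedBall.isOpen_compl.mem_nhds hx] with y hy
        apply b.zero_of_le_dist
        rw [dist_zero_right, norm_smul, norm_inv, Real.norm_of_nonneg hr.le, ← dist_eq_norm,
          le_inv_mul_iff₀ hr, mul_comm]
        exact (not_le.1 (mem_closedBall.not.1 hy)).le
      rw [this.fderiv_eq]
      simp

/-- A smooth cutoff equal to one on a finite union of balls, whose size and gradient are controlled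
by the sum of the contributions of the balls. -/
theorem exists_cutoff (E : Type*) [NormedAddCommGroup E] [NormedSpace ℝ E]
    [FiniteDimensional ℝ E] :
    ∃ L : ℝ, 0 ≤ L ∧ ∀ {ι : Type} (s : Finset ι) (c : ι → E) (r : ι → ℝ), (∀ j ∈ s, 0 < r j) →
      ∃ θ : E → ℝ, ContDiff ℝ ∞ θ ∧ (∀ x, 0 ≤ θ x ∧ θ x ≤ 1) ∧
      (∀ j ∈ s, ∀ x ∈ ball (c j) (r j), θ x = 1) ∧
      (∀ x, θ x ≤ ∑ j ∈ s, (closedBall (c j) (2 * r j)).indicator 1 x) ∧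
      (∀ x, ‖fderiv ℝ θ x‖ ≤ ∑ j ∈ s, (closedBall (c j) (2 * r j)).indicator
        (fun _ => L / r j) x) := by
  classical
  obtain ⟨L, hL, hb⟩ := exists_bump E
  refine ⟨L, hL, fun s c r => ?_⟩
  induction s using Finset.induction_on with
  | empty => exact fun _ => ⟨fun _ => 0, contDiff_const, by simp⟩
  | insert j s hj ih =>
    intro hr
    obtain ⟨θ, hθ, hθ01, hθ1, hθs, hθd⟩ := ih fun k hk => hr k (Finset.mem_insert_of_mem hk)
    obtain ⟨χ, hχ, hχ01, hχ1, hχs, hχd⟩ := hb (c j) (r j) (hr j (Finset.mem_insert_self _ _))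
    refine ⟨fun x => θ x + χ x - θ x * χ x, (hθ.add hχ).sub (hθ.mul hχ), ?_, ?_, ?_, ?_⟩
    · intro x
      obtain ⟨h1, h2⟩ := hθ01 x
      obtain ⟨h3, h4⟩ := hχ01 x
      constructor <;> nlinarith
    · intro k hk x hx
      rcases Finset.mem_insert.1 hk with rfl | hk
      · simp [hχ1 x hx]
      · simp [hθ1 k hk x hx]
    · intro x
      rw [Finset.sum_insert hj]
      have := hθs x
      have := hχs x
      have := mul_nonneg (hθ01 x).1 (hχ01 x).1
      linarith
    · intro x
      rw [Finset.sum_insert hj]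
      have hθx := ((hθ.differentiable (by simp)) x).hasFDerivAt
      have hχx := ((hχ.differentiable (by simp)) x).hasFDerivAt
      have h := (hθx.add hχx).sub (hθx.mul hχx)
      have h' : fderiv ℝ (fun x => θ x + χ x - θ x * χ x) x =
          (1 - χ x) • fderiv ℝ θ x + (1 - θ x) • fderiv ℝ χ x := by
        rw [HasFDerivAt.fderiv (f := fun x => θ x + χ x - θ x * χ x) h]
        module
      rw [h']
      have key : ∀ (t : ℝ) (T : E →L[ℝ] ℝ), 0 ≤ t → t ≤ 1 → ‖(1 - t) • T‖ ≤ ‖T‖ := by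
        intro t T h0 h1
        rw [norm_smul, Real.norm_of_nonneg (by linarith)]
        exact mul_le_of_le_one_left (norm_nonneg _) (by linarith)
      calc _ ≤ ‖fderiv ℝ θ x‖ + ‖fderiv ℝ χ x‖ := (norm_add_le _ _).trans
            (add_le_add (key _ _ (hχ01 x).1 (hχ01 x).2) (key _ _ (hθ01 x).1 (hθ01 x).2))
        _ ≤ _ := by
            rw [add_comm]
            exact add_le_add (hχd x) (hθd x)

/-! ### Integrals of derivatives are controlled by the boundary -/

/-- On a bounded open set, the derivative of a function that vanishes near the boundary integrates
to zero. -/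
theorem setIntegral_fderiv_eq_zero {d : ℕ} {D O : Set (Space d)} (hD : IsOpen D)
    (hb : Bornology.IsBounded D) (hO : IsOpen O) (hDO : frontier D ⊆ O) {w : Space d → ℂ}
    (hw : ContDiff ℝ 1 w) (hw0 : ∀ x ∈ O, w x = 0) (e : Space d) :
    ∫ x in D, fderiv ℝ w x e = 0 := by
  have hin : ∀ x ∈ D, D.indicator w =ᶠ[𝓝 x] w := fun x hx => by
    filter_upwards [hD.mem_nhds hx] with y hy using indicator_of_mem hy _
  have hout : ∀ x ∉ D, D.indicator w =ᶠ[𝓝 x] fun _ => 0 := fun x hx => by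
    by_cases hxc : x ∈ closure D
    · have hxf : x ∈ frontier D := ⟨hxc, by rwa [hD.interior_eq]⟩
      filter_upwards [hO.mem_nhds (hDO hxf)] with y hy
      simp [hw0 y hy]
    · filter_upwards [isClosed_closure.isOpen_compl.mem_nhds hxc] with y hy
      exact indicator_of_notMem (fun h => hy (subset_closure h)) _
  have hsm : ContDiff ℝ 1 (D.indicator w) := by
    rw [contDiff_iff_contDiffAt]
    intro x
    by_cases hx : x ∈ D
    · exact hw.contDiffAt.congr_of_eventuallyEq (hin x hx)
    · exact contDiffAt_const.congr_of_eventuallyEq (hout x hx)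
  have hcs : HasCompactSupport (D.indicator w) := by
    refine HasCompactSupport.of_support_subset_isCompact hb.isCompact_closure ?_
    exact support_indicator_subset.trans subset_closure
  rw [← integral_fderiv_apply_eq_zero volume hsm hcs e, ← integral_indicator hD.measurableSet]
  congr 1 with x
  by_cases hx : x ∈ D
  · rw [indicator_of_mem hx, (hin x hx).fderiv_eq]
  · rw [indicator_of_notMem hx, (hout x hx).fderiv_eq]
    simp

theorem integrableOn_of_continuous {d : ℕ} {D : Set (Space d)} (hb : Bornology.IsBounded D)
    {F : Type*} [NormedAddCommGroup F] {f : Space d → F} (hf : Continuous f) :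
    IntegrableOn f D :=
  (hf.continuousOn.integrableOn_compact hb.isCompact_closure).mono_set subset_closure

/-- The integral of a derivative over `D` is bounded in terms of any finite cover of the boundary
by balls: multiply by a cutoff that removes the balls, and apply `setIntegral_fderiv_eq_zero`. -/
theorem norm_setIntegral_fderiv_le_of_cover (d : ℕ) :
    ∃ L : ℝ, 0 ≤ L ∧ ∀ {D : Set (Space d)}, IsOpen D → Bornology.IsBounded D →
      ∀ {w : Space d → ℂ}, ContDiff ℝ 1 w → ∀ {e : Space d}, ‖e‖ ≤ 1 →
      ∀ {M : ℝ}, (∀ x, ‖fderiv ℝ w x e‖ ≤ M) →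
      ∀ {ι : Type} (s : Finset ι) (c : ι → Space d) (r B : ι → ℝ), (∀ j ∈ s, 0 < r j) →
      frontier D ⊆ ⋃ j ∈ s, ball (c j) (r j) →
      (∀ j ∈ s, ∀ x ∈ closedBall (c j) (2 * r j), ‖w x‖ ≤ B j) →
      ‖∫ x in D, fderiv ℝ w x e‖ ≤
        ∑ j ∈ s, (M + L / r j * B j) * volume.real (closedBall (c j) (2 * r j)) := by
  obtain ⟨L, hL, hcut⟩ := exists_cutoff (Space d)
  refine ⟨L, hL, fun {D} hD hb {w} hw {e} he {M} hM {ι} s c r B hr hcov hB => ?_⟩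
  obtain ⟨θ, hθ, hθ01, hθ1, hθs, hθd⟩ := hcut s c r hr
  have hθC : ContDiff ℝ 1 (fun x => (θ x : ℂ)) :=
    Complex.ofRealCLM.contDiff.comp (hθ.of_le (by simp))
  have hθw : ContDiff ℝ 1 (fun x => (θ x : ℂ) * w x) := hθC.mul hw
  have hM0 : 0 ≤ M := (norm_nonneg _).trans (hM 0)
  have hB0 : ∀ j ∈ s, 0 ≤ B j := fun j hj => (norm_nonneg _).trans
    (hB j hj (c j) (mem_closedBall_self (by have := hr j hj; positivity)))
  have hzero : ∫ x in D, fderiv ℝ (fun x => w x - θ x * w x) x e = 0 := by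
    refine setIntegral_fderiv_eq_zero hD hb (O := ⋃ j ∈ s, ball (c j) (r j))
      (isOpen_biUnion fun _ _ => isOpen_ball) hcov (hw.sub hθw) ?_ e
    intro x hx
    obtain ⟨j, hj, hx⟩ := mem_iUnion₂.1 hx
    simp [hθ1 j hj x hx]
  have hcont1 : Continuous fun x => fderiv ℝ w x e :=
    (hw.continuous_fderiv one_ne_zero).clm_apply continuous_const
  have hcont2 : Continuous fun x => fderiv ℝ (fun x => (θ x : ℂ) * w x) x e :=
    (hθw.continuous_fderiv one_ne_zero).clm_apply continuous_const
  have heq : ∫ x in D, fderiv ℝ w x e = ∫ x in D, fderiv ℝ (fun x => (θ x : ℂ) * w x) x e := by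
    have hsub : ∀ x, fderiv ℝ (fun x => w x - θ x * w x) x e =
        fderiv ℝ w x e - fderiv ℝ (fun x => (θ x : ℂ) * w x) x e := fun x => by
      rw [fderiv_fun_sub ((hw.differentiable one_ne_zero) x)
        ((hθw.differentiable one_ne_zero) x)]
      rfl
    simp only [hsub] at hzero
    rwa [integral_sub (integrableOn_of_continuous hb hcont1)
      (integrableOn_of_continuous hb hcont2), sub_eq_zero] at hzero
  set g : Space d → ℝ := fun x => ∑ j ∈ s, (closedBall (c j) (2 * r j)).indicator
    (fun _ => M + L / r j * B j) x with hg
  have hpt : ∀ x, ‖fderiv ℝ (fun x => (θ x : ℂ) * w x) x e‖ ≤ g x := by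
    intro x
    have h1 : HasFDerivAt (fun x => (θ x : ℂ)) (Complex.ofRealCLM.comp (fderiv ℝ θ x)) x :=
      Complex.ofRealCLM.hasFDerivAt.comp x ((hθ.differentiable (by simp)) x).hasFDerivAt
    have h2 := ((hw.differentiable one_ne_zero) x).hasFDerivAt
    rw [HasFDerivAt.fderiv (f := fun x => (θ x : ℂ) * w x) (h1.mul h2)]
    have h3 : ((θ x : ℂ) • fderiv ℝ w x + w x • Complex.ofRealCLM.comp (fderiv ℝ θ x)) e =
      θ x * fderiv ℝ w x e + w x * (fderiv ℝ θ x e : ℂ) := by simp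
    have h4 : ‖fderiv ℝ θ x e‖ ≤ ‖fderiv ℝ θ x‖ :=
      ((fderiv ℝ θ x).le_opNorm e).trans (mul_le_of_le_one_right (norm_nonneg _) he)
    rw [h3]
    calc _ ≤ θ x * M + ‖fderiv ℝ θ x‖ * ‖w x‖ := by
          refine (norm_add_le _ _).trans ?_
          rw [norm_mul, norm_mul, mul_comm ‖w x‖, Complex.norm_real, Complex.norm_real,
            Real.norm_of_nonneg (hθ01 x).1]
          gcongr
          · exact (hθ01 x).1
          · exact hM x
      _ ≤ (∑ j ∈ s, (closedBall (c j) (2 * r j)).indicator 1 x) * M +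
          (∑ j ∈ s, (closedBall (c j) (2 * r j)).indicator (fun _ => L / r j) x) * ‖w x‖ := by
          gcongr
          · exact hθs x
          · exact hθd x
      _ ≤ g x := by
          rw [Finset.sum_mul, Finset.sum_mul, ← Finset.sum_add_distrib]
          refine Finset.sum_le_sum fun j hj => ?_
          by_cases hx : x ∈ closedBall (c j) (2 * r j)
          · simp only [indicator_of_mem hx, Pi.one_apply, one_mul]
            have := hr j hj
            gcongr
            exact hB j hj x hx
          · simp [indicator_of_notMem hx]
  have hgint : Integrable g := by
    refine integrable_finsetSum _ fun j _ => ?_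
    exact (integrable_indicator_iff isClosed_closedBall.measurableSet).2
      (integrableOn_const (isCompact_closedBall _ _).measure_lt_top.ne)
  have hg0 : ∀ x, 0 ≤ g x := fun x => (norm_nonneg _).trans (hpt x)
  rw [heq]
  calc _ ≤ ∫ x in D, g x := norm_integral_le_of_norm_le hgint.integrableOn (ae_of_all _ hpt)
    _ ≤ ∫ x, g x := setIntegral_le_integral hgint (ae_of_all _ hg0)
    _ = _ := by
      rw [hg, integral_finsetSum]
      · refine Finset.sum_congr rfl fun j _ => ?_
        rw [integral_indicator isClosed_closedBall.measurableSet, setIntegral_const, smul_eq_mul,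
          mul_comm]
      · intro j _
        exact (integrable_indicator_iff isClosed_closedBall.measurableSet).2
          (integrableOn_const (isCompact_closedBall _ _).measure_lt_top.ne)

/-- The integral over `D` of a derivative of `w` is controlled by the integral of `|w|` over the
boundary, for every bounded open set with a boundary of finite surface measure. -/
theorem enorm_setIntegral_fderiv_le (d : ℕ) (hd : 2 ≤ d) :
    ∃ C : ℝ≥0∞, C ≠ ⊤ ∧ ∀ {D : Set (Space d)}, IsOpen D → Bornology.IsBounded D →
      Measure.hausdorffMeasure ((d - 1 : ℕ) : ℝ) (frontier D) ≠ ⊤ →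
      ∀ {w : Space d → ℂ}, ContDiff ℝ 1 w → HasCompactSupport w → ∀ {e : Space d}, ‖e‖ ≤ 1 →
      ‖∫ x in D, fderiv ℝ w x e‖ₑ ≤
        C * ∫⁻ x in frontier D, ‖w x‖ₑ ∂(Measure.hausdorffMeasure ((d - 1 : ℕ) : ℝ)) := by
  obtain ⟨L, hL, hcover⟩ := norm_setIntegral_fderiv_le_of_cover d
  set v : ℝ := volume.real (ball (0 : Space d) 1) with hv
  have hv0 : 0 ≤ v := measureReal_nonneg
  refine ⟨ENNReal.ofReal (2 ^ d * v) * ENNReal.ofReal L,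
    ENNReal.mul_ne_top ENNReal.ofReal_ne_top ENNReal.ofReal_ne_top,
    fun {D} hD hb hfin {w} hw hwc {e} he => ?_⟩
  obtain ⟨M, hM⟩ := (hwc.fderiv_apply (𝕜 := ℝ) e).exists_bound_of_continuous
    ((hw.continuous_fderiv one_ne_zero).clm_apply continuous_const)
  have hM0 : 0 ≤ M := (norm_nonneg _).trans (hM 0)
  set μ : Measure (Space d) := Measure.hausdorffMeasure ((d - 1 : ℕ) : ℝ) with hμ
  set K := frontier D with hK
  set J : ℝ≥0∞ := ∫⁻ x in K, ‖w x‖ₑ ∂μ with hJ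
  set C₀ : ℝ≥0∞ := ENNReal.ofReal (2 ^ d * v) with hC₀
  have hmain : ∀ ε : ℝ, 0 < ε → ε ≤ 1 → ‖∫ x in D, fderiv ℝ w x e‖ₑ ≤
      C₀ * (ENNReal.ofReal ε * (ENNReal.ofReal (M + 2 * L) * μ K + 1) + ENNReal.ofReal L * J) := by
    intro ε hε hε1
    obtain ⟨δ₀, hδ₀, hunif⟩ := Metric.uniformContinuous_iff.1
      (hwc.uniformContinuous_of_continuous hw.continuous) ε hε
    set δ := min ε (δ₀ / 4) with hδ
    have hδ0 : 0 < δ := by positivity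
    -- The boundary is cut into layers on which `|w|` is constant up to `ε`.
    set A : ℕ → Set (Space d) := fun k => K ∩ {x | ⌊‖w x‖ / ε⌋₊ = k} with hA
    have hAm : ∀ k, MeasurableSet (A k) := by
      intro k
      refine isClosed_frontier.measurableSet.inter ?_
      have : Measurable fun x => ⌊‖w x‖ / ε⌋₊ :=
        Nat.measurable_floor.comp (hw.continuous.norm.measurable.div_const ε)
      exact this (measurableSet_singleton k)
    have hAfin : ∀ k, μ (A k) ≠ ⊤ := fun k => measure_ne_top_of_subset inter_subset_left hfin
    -- `ε' k / (N k + 1)` is the excess allowed in the cover of the `k`-th layer, whose balls carry the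
    -- weight `N k`.
    obtain ⟨ε', hε', hsum⟩ := ENNReal.exists_pos_sum_of_countable
      (ε := ENNReal.ofReal ε) (by simpa using hε) ℕ
    set N : ℕ → ℝ≥0∞ := fun k => ENNReal.ofReal (ε * (M + L * (k + 2))) with hN
    have hNtop : ∀ k, N k ≠ ⊤ := fun k => ENNReal.ofReal_ne_top
    have hcov : ∀ k, ∃ (I : Set ℕ) (c : ℕ → Space d) (r : ℕ → ℝ), (∀ n, 0 < r n ∧ r n ≤ δ) ∧
        (∀ n ∈ I, c n ∈ A k) ∧ A k ⊆ ⋃ n ∈ I, ball (c n) (r n) ∧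
        ∑' n, ENNReal.ofReal (r n) ^ (d - 1) ≤ μ (A k) + ε' k / (N k + 1) := by
      intro k
      refine exists_ball_cover (by omega) (A k) ?_ hδ0
      refine ENNReal.lt_add_right (hAfin k) ?_
      refine (ENNReal.div_pos (by simpa using (hε' k).ne') ?_).ne'
      simp [hNtop]
    choose I c r hr hcA hAcov hrsum using hcov
    have hKc : IsCompact K := hb.isCompact_closure.of_isClosed_subset isClosed_frontier
      frontier_subset_closure
    obtain ⟨b', hb', hb'fin, hKb⟩ := hKc.elim_finite_subcover_image
      (b := {p : ℕ × ℕ | p.2 ∈ I p.1}) (c := fun p => ball (c p.1 p.2) (r p.1 p.2))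
      (fun _ _ => isOpen_ball) (by
        intro x hx
        have hxA : x ∈ A ⌊‖w x‖ / ε⌋₊ := ⟨hx, rfl⟩
        obtain ⟨n, hn, hxn⟩ := mem_iUnion₂.1 (hAcov _ hxA)
        exact mem_iUnion₂.2 ⟨(_, n), hn, hxn⟩)
    lift b' to Finset (ℕ × ℕ) using hb'fin
    have hbound := hcover hD hb hw he hM b' (fun p => c p.1 p.2) (fun p => r p.1 p.2)
      (fun p => (p.1 + 2) * ε) (fun p _ => (hr _ _).1) (by simpa using hKb) (by
        intro p hp x hx
        have hcp := hcA p.1 p.2 (hb' hp)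
        have h1 : ‖w (c p.1 p.2)‖ < (p.1 + 1) * ε := by
          have := Nat.lt_floor_add_one (‖w (c p.1 p.2)‖ / ε)
          rw [hcp.2] at this
          rwa [div_lt_iff₀ hε] at this
        have h2 : dist (w x) (w (c p.1 p.2)) < ε := by
          apply hunif
          have h3 := mem_closedBall.1 hx
          have h4 := (hr p.1 p.2).2
          have h5 : δ ≤ δ₀ / 4 := min_le_right _ _
          linarith
        rw [dist_eq_norm] at h2
        have h3 : ‖w x‖ ≤ ‖w x - w (c p.1 p.2)‖ + ‖w (c p.1 p.2)‖ := by
          simpa using norm_add_le (w x - w (c p.1 p.2)) (w (c p.1 p.2))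
        linarith)
    have hterm : ∀ p : ℕ × ℕ, ENNReal.ofReal ((M + L / r p.1 p.2 * ((p.1 + 2) * ε)) *
        volume.real (closedBall (c p.1 p.2) (2 * r p.1 p.2))) ≤
        C₀ * (N p.1 * ENNReal.ofReal (r p.1 p.2) ^ (d - 1)) := by
      intro p
      obtain ⟨hr0, hrδ⟩ := hr p.1 p.2
      set ρ := r p.1 p.2
      have hρε : ρ ≤ ε := hrδ.trans (min_le_left _ _)
      rw [hC₀, hN, ← ENNReal.ofReal_pow hr0.le, ← ENNReal.ofReal_mul (by positivity),
        ← ENNReal.ofReal_mul (by positivity)]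
      apply ENNReal.ofReal_le_ofReal
      rw [Measure.addHaar_real_closedBall volume _ (by positivity), finrank_euclideanSpace,
        Fintype.card_fin, ← hv]
      have hpow : ρ ^ d = ρ * ρ ^ (d - 1) := by
        rw [← pow_succ', Nat.sub_add_cancel (by omega)]
      have : (M + L / ρ * ((p.1 + 2) * ε)) * ((2 * ρ) ^ d * v) =
          2 ^ d * v * ((M * ρ + L * (p.1 + 2) * ε) * ρ ^ (d - 1)) := by
        rw [mul_pow, hpow]
        field_simp
      rw [this]
      gcongr
      nlinarith
    have hlayer : ∀ k : ℕ, ENNReal.ofReal (k * ε) * μ (A k) ≤ ∫⁻ x in A k, ‖w x‖ₑ ∂μ := by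
      intro k
      rw [← setLIntegral_const]
      refine setLIntegral_mono hw.continuous.enorm.measurable fun x hx => ?_
      rw [← ofReal_norm]
      apply ENNReal.ofReal_le_ofReal
      rw [← le_div_iff₀ hε, ← hx.2]
      exact Nat.floor_le (by positivity)
    have hdisj : Pairwise (Function.onFun Disjoint A) := fun i j hij =>
      Set.disjoint_left.2 fun x hi hj => hij (hi.2.symm.trans hj.2)
    have hAK : ⋃ k, A k = K := by
      ext x
      simp [hA]
    have hsumμ : ∑' k, μ (A k) = μ K := by
      rw [← measure_iUnion hdisj hAm, hAK]
    have hsumJ : ∑' k, ∫⁻ x in A k, ‖w x‖ₑ ∂μ = J := by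
      rw [← lintegral_iUnion hAm hdisj, hAK]
    calc ‖∫ x in D, fderiv ℝ w x e‖ₑ
        = ENNReal.ofReal ‖∫ x in D, fderiv ℝ w x e‖ := (ofReal_norm _).symm
      _ ≤ ENNReal.ofReal (∑ p ∈ b', (M + L / r p.1 p.2 * ((p.1 + 2) * ε)) *
            volume.real (closedBall (c p.1 p.2) (2 * r p.1 p.2))) :=
          ENNReal.ofReal_le_ofReal hbound
      _ = ∑ p ∈ b', ENNReal.ofReal ((M + L / r p.1 p.2 * ((p.1 + 2) * ε)) *
            volume.real (closedBall (c p.1 p.2) (2 * r p.1 p.2))) := by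
          refine ENNReal.ofReal_sum_of_nonneg fun p _ => ?_
          have := (hr p.1 p.2).1
          positivity
      _ ≤ ∑' p : ℕ × ℕ, C₀ * (N p.1 * ENNReal.ofReal (r p.1 p.2) ^ (d - 1)) :=
          (Finset.sum_le_sum fun p _ => hterm p).trans (ENNReal.sum_le_tsum _)
      _ = C₀ * ∑' k, N k * ∑' n, ENNReal.ofReal (r k n) ^ (d - 1) := by
          rw [ENNReal.tsum_mul_left, ENNReal.tsum_prod']
          simp only [ENNReal.tsum_mul_left]
      _ ≤ C₀ * ∑' k, (N k * μ (A k) + ε' k) := by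
          gcongr with k
          calc N k * ∑' n, ENNReal.ofReal (r k n) ^ (d - 1)
              ≤ N k * (μ (A k) + ε' k / (N k + 1)) := by gcongr; exact hrsum k
            _ = N k * μ (A k) + N k * (ε' k / (N k + 1)) := mul_add _ _ _
            _ ≤ N k * μ (A k) + (N k + 1) * (ε' k / (N k + 1)) := by
                gcongr
                exact le_self_add
            _ ≤ N k * μ (A k) + ε' k := by
                gcongr
                exact ENNReal.mul_div_le
      _ = C₀ * (∑' k, N k * μ (A k) + ∑' k, (ε' k : ℝ≥0∞)) := by rw [ENNReal.tsum_add]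
      _ ≤ C₀ * ((ENNReal.ofReal (ε * (M + 2 * L)) * μ K + ENNReal.ofReal L * J) +
            ENNReal.ofReal ε) := by
          gcongr
          calc ∑' k, N k * μ (A k)
              = ∑' k, (ENNReal.ofReal (ε * (M + 2 * L)) * μ (A k) +
                  ENNReal.ofReal L * (ENNReal.ofReal (k * ε) * μ (A k))) := by
                refine tsum_congr fun k => ?_
                simp only [hN]
                rw [← mul_assoc, ← add_mul, ← ENNReal.ofReal_mul hL,
                  ← ENNReal.ofReal_add (by positivity) (by positivity)]
                congr 2
                ring
            _ ≤ ∑' k, (ENNReal.ofReal (ε * (M + 2 * L)) * μ (A k) +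
                  ENNReal.ofReal L * ∫⁻ x in A k, ‖w x‖ₑ ∂μ) := by
                gcongr with k
                exact hlayer k
            _ = _ := by
                rw [ENNReal.tsum_add, ENNReal.tsum_mul_left, ENNReal.tsum_mul_left, hsumμ, hsumJ]
      _ = _ := by
          rw [ENNReal.ofReal_mul hε.le]
          ring
  have hlim : Tendsto (fun ε : ℝ => C₀ * (ENNReal.ofReal ε *
      (ENNReal.ofReal (M + 2 * L) * μ K + 1) + ENNReal.ofReal L * J)) (𝓝[>] 0)
      (𝓝 (C₀ * (ENNReal.ofReal 0 * (ENNReal.ofReal (M + 2 * L) * μ K + 1) +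
        ENNReal.ofReal L * J))) := by
    refine ENNReal.Tendsto.const_mul (Tendsto.add (ENNReal.Tendsto.mul_const
      (ENNReal.tendsto_ofReal (tendsto_id.mono_left nhdsWithin_le_nhds)) (Or.inr ?_))
      tendsto_const_nhds) (Or.inr ENNReal.ofReal_ne_top)
    exact ENNReal.add_ne_top.2 ⟨ENNReal.mul_ne_top ENNReal.ofReal_ne_top hfin, ENNReal.one_ne_top⟩
  rw [ENNReal.ofReal_zero, zero_mul, zero_add, ← mul_assoc] at hlim
  refine ge_of_tendsto hlim ?_
  filter_upwards [Ioc_mem_nhdsGT (zero_lt_one' ℝ)] with ε hε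
  exact hmain ε hε.1 hε.2

/-! ### Finiteness of the surface measure -/

/-- A defining function vanishes on the boundary. -/
theorem eq_zero_of_mem_frontier {d : ℕ} {D U : Set (Space d)} {ρ : Space d → ℝ} (hD : IsOpen D)
    (hU : IsOpen U) (hρ : ContinuousOn ρ U) (h : ∀ x ∈ U, (x ∈ D ↔ ρ x < 0)) {x : Space d}
    (hx : x ∈ frontier D) (hxU : x ∈ U) : ρ x = 0 := by
  refine le_antisymm (not_lt.1 fun hpos => ?_)
    (not_lt.1 fun hneg => (hD.frontier_eq ▸ hx).2 ((h x hxU).2 hneg))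
  have h1 : ∀ᶠ y in 𝓝 x, 0 < ρ y :=
    (hρ.continuousAt (hU.mem_nhds hxU)).eventually (lt_mem_nhds hpos)
  obtain ⟨y, hyD, hy, hyU⟩ := ((mem_closure_iff_frequently.1 hx.1).and_eventually
    (h1.and (hU.mem_nhds hxU))).exists
  exact absurd ((h y hyU).1 hyD) (not_lt.2 hy.le)

/-- If a linear form nearly vanishes on `z` while its `i`-th coefficient does not, then `z` is
controlled by its coordinates other than the `i`-th one. -/
theorem norm_le_mul_norm_of_apply_small {d : ℕ} (T : Space d →L[ℝ] ℝ) (i : Fin d)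
    (ha : T (EuclideanSpace.single i 1) ≠ 0) {z : Space d}
    (hz : |T z| ≤ |T (EuclideanSpace.single i 1)| / 2 * ‖z‖) :
    ‖z‖ ≤ (2 * d + 2 * ‖T‖ * d / |T (EuclideanSpace.single i 1)|) *
      ‖fun j : {j : Fin d // j ≠ i} => z j‖ := by
  classical
  set a := |T (EuclideanSpace.single i 1)| with hadef
  have ha0 : 0 < a := abs_pos.2 ha
  set q := ‖fun j : {j : Fin d // j ≠ i} => z j‖ with hq
  set z' : Space d := z - z i • EuclideanSpace.single i (1 : ℝ) with hz'
  have hz'j : ∀ j, ‖z' j‖ ≤ q := by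
    intro j
    by_cases hj : j = i
    · subst hj
      simp [hz', hq]
    · have h1 : z' j = z j := by simp [hz', hj]
      rw [h1]
      exact norm_le_pi_norm (fun j : {j : Fin d // j ≠ i} => z j) ⟨j, hj⟩
  have hz'n : ‖z'‖ ≤ d * q := by
    have h1 : z' = ∑ j, z' j • EuclideanSpace.single j (1 : ℝ) := by
      ext k
      simp [Finset.sum_apply, Pi.single_apply]
    rw [h1]
    refine (norm_sum_le _ _).trans ?_
    calc ∑ j, ‖z' j • EuclideanSpace.single j (1 : ℝ)‖ ≤ ∑ _j : Fin d, q := by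
          refine Finset.sum_le_sum fun j _ => ?_
          rw [norm_smul]
          simpa using hz'j j
      _ = d * q := by simp
  have hdec : z = z' + z i • EuclideanSpace.single i (1 : ℝ) := by simp [hz']
  have hzn : ‖z‖ ≤ d * q + |z i| := by
    calc ‖z‖ = ‖z' + z i • EuclideanSpace.single i (1 : ℝ)‖ := by rw [← hdec]
      _ ≤ ‖z'‖ + ‖z i • EuclideanSpace.single i (1 : ℝ)‖ := norm_add_le _ _
      _ ≤ d * q + |z i| := by
        rw [norm_smul]
        simpa using hz'n
  have hT : |z i| * a ≤ |T z| + ‖T‖ * (d * q) := by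
    have h1 : z i * T (EuclideanSpace.single i 1) = T z - T z' := by
      rw [hz']
      simp
    rw [hadef, ← abs_mul, h1]
    refine (abs_sub _ _).trans ?_
    gcongr
    exact (T.le_opNorm z').trans (by gcongr)
  have h2 : |z i| * a ≤ a * (d * q) + 2 * ‖T‖ * (d * q) := by nlinarith
  have h3 : |z i| ≤ d * q + 2 * ‖T‖ * (d * q) / a := by
    rw [← sub_nonneg]
    have : d * q + 2 * ‖T‖ * (d * q) / a - |z i| =
        (a * (d * q) + 2 * ‖T‖ * (d * q) - |z i| * a) / a := by
      field_simp
    rw [this]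
    exact div_nonneg (by linarith) ha0.le
  calc ‖z‖ ≤ d * q + (d * q + 2 * ‖T‖ * (d * q) / a) := by linarith
    _ = _ := by ring

/-- A bounded open set with `C²` boundary has a boundary of finite `(d-1)`-dimensional measure:
locally, the projection along a coordinate axis that is transversal to the boundary distorts
distances by a bounded factor. -/
theorem hausdorffMeasure_frontier_ne_top {d : ℕ} {D : Set (Space d)} (hD : IsOpen D)
    (hb : Bornology.IsBounded D) (hC : HasC2Boundary D) :
    Measure.hausdorffMeasure ((d - 1 : ℕ) : ℝ) (frontier D) ≠ ⊤ := by
  classical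
  have hKc : IsCompact (frontier D) := hb.isCompact_closure.of_isClosed_subset isClosed_frontier
    frontier_subset_closure
  refine (hKc.measure_lt_top_of_nhdsWithin fun p hp => ?_).ne
  obtain ⟨U, ρ, hU, hpU, hρ, hρp, hDρ⟩ := hC p hp
  set T := fderiv ℝ ρ p with hT
  obtain ⟨i, hi⟩ : ∃ i, T (EuclideanSpace.single i 1) ≠ 0 := by
    by_contra! hcon
    refine hρp (ContinuousLinearMap.ext fun x => ?_)
    have h1 : x = ∑ j, x j • EuclideanSpace.single j (1 : ℝ) := by
      ext k
      simp [Finset.sum_apply, Pi.single_apply]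
    rw [h1, map_sum]
    simp [hcon]
  have hstrict : HasStrictFDerivAt ρ T p :=
    (hρ.contDiffAt (hU.mem_nhds hpU)).hasStrictFDerivAt (by simp)
  have ha0 : 0 < |T (EuclideanSpace.single i 1)| / 2 := by positivity
  have hev := hstrict.isLittleO.def ha0
  rw [eventually_iff, mem_nhds_prod_iff] at hev
  obtain ⟨V₁, hV₁, V₂, hV₂, hVV⟩ := hev
  set S := frontier D ∩ (V₁ ∩ V₂ ∩ U ∩ ball p 1) with hS
  have hSmem : S ∈ 𝓝[frontier D] p := inter_mem self_mem_nhdsWithin (mem_nhdsWithin_of_mem_nhds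
    (inter_mem (inter_mem (inter_mem hV₁ hV₂) (hU.mem_nhds hpU)) (ball_mem_nhds p one_pos)))
  refine ⟨S, hSmem, ?_⟩
  -- The projection that forgets the transversal coordinate is antilipschitz on the boundary.
  set κ : ℝ := 2 * d + 2 * ‖T‖ * d / |T (EuclideanSpace.single i 1)| with hκ
  have hκ0 : 0 ≤ κ := by positivity
  let q : S → ({j : Fin d // j ≠ i} → ℝ) := fun x j => (x : Space d) j
  have hanti : AntilipschitzWith ⟨κ, hκ0⟩ q := by
    refine AntilipschitzWith.of_le_mul_dist fun x y => ?_
    have hx := x.2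
    have hy := y.2
    have h1 := hVV (Set.mk_mem_prod hx.2.1.1.1 hy.2.1.1.2)
    simp only [mem_ofPred_eq, eq_zero_of_mem_frontier hD hU hρ.continuousOn hDρ hx.1 hx.2.1.2,
      eq_zero_of_mem_frontier hD hU hρ.continuousOn hDρ hy.1 hy.2.1.2, sub_self, zero_sub,
      norm_neg] at h1
    have h2 := norm_le_mul_norm_of_apply_small T i hi h1
    rw [Subtype.dist_eq, dist_eq_norm, dist_eq_norm]
    exact h2
  have hcard : ((d - 1 : ℕ) : ℝ) = (Fintype.card {j : Fin d // j ≠ i} : ℝ) := by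
    simp [Fintype.card_subtype_compl]
  have hSim : Measure.hausdorffMeasure ((d - 1 : ℕ) : ℝ) S =
      Measure.hausdorffMeasure ((d - 1 : ℕ) : ℝ) (univ : Set S) := by
    have h1 := (isometry_subtype_coe (s := S)).hausdorffMeasure_image
      (d := ((d - 1 : ℕ) : ℝ)) (Or.inl (by positivity)) univ
    rw [← h1, image_univ, Subtype.range_coe]
  have hqb : q '' univ ⊆ closedBall (fun j : {j : Fin d // j ≠ i} => p j) 1 := by
    rintro _ ⟨x, -, rfl⟩
    rw [mem_closedBall, dist_pi_le_iff zero_le_one]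
    intro j
    have h1 : dist (x : Space d) p < 1 := x.2.2.2
    rw [dist_eq_norm] at h1 ⊢
    exact (PiLp.norm_apply_le ((x : Space d) - p) (j : Fin d)).trans h1.le
  rw [hSim]
  refine (hanti.le_hausdorffMeasure_image (by positivity) univ).trans_lt ?_
  refine ENNReal.mul_lt_top (ENNReal.rpow_lt_top_of_nonneg (by positivity) ENNReal.coe_ne_top) ?_
  refine (measure_mono hqb).trans_lt ?_
  rw [hcard, hausdorffMeasure_pi_real]
  exact measure_closedBall_lt_top

/-- The surface measure is a positive multiple of the restricted Hausdorff measure. -/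
theorem exists_surfaceMeasure_eq_smul {d : ℕ} (D : Set (Space d)) : ∃ k : ℝ≥0, k ≠ 0 ∧
    surfaceMeasure D =
      k • (Measure.hausdorffMeasure ((d - 1 : ℕ) : ℝ)).restrict (frontier D) := by
  refine ⟨_, Measure.addHaarScalarFactor_volume_hausdorffMeasure_ne_zero (d - 1), ?_⟩
  rw [surfaceMeasure, Measure.euclideanHausdorffMeasure_def, Measure.restrict_smul]

theorem exists_lintegral_frontier_le {d : ℕ} (D : Set (Space d)) : ∃ k : ℝ≥0∞, k ≠ ⊤ ∧
    ∀ f : Space d → ℝ≥0∞, ∫⁻ x in frontier D, f x ∂(Measure.hausdorffMeasure ((d - 1 : ℕ) : ℝ)) ≤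
      k * ∫⁻ x, f x ∂(surfaceMeasure D) := by
  obtain ⟨k, hk0, hk⟩ := exists_surfaceMeasure_eq_smul D
  refine ⟨(k : ℝ≥0∞)⁻¹, by simpa using hk0, fun f => ?_⟩
  rw [hk, lintegral_smul_measure, ENNReal.smul_def, smul_eq_mul, ← mul_assoc,
    ENNReal.inv_mul_cancel (by simpa using hk0) ENNReal.coe_ne_top, one_mul]

theorem isFiniteMeasure_surfaceMeasure {d : ℕ} {D : Set (Space d)} (hD : IsOpen D)
    (hb : Bornology.IsBounded D) (hC : HasC2Boundary D) : IsFiniteMeasure (surfaceMeasure D) := by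
  obtain ⟨k, -, hk⟩ := exists_surfaceMeasure_eq_smul D
  have : IsFiniteMeasure ((Measure.hausdorffMeasure ((d - 1 : ℕ) : ℝ)).restrict (frontier D)) :=
    ⟨by simpa using (hausdorffMeasure_frontier_ne_top hD hb hC).lt_top⟩
  rw [hk]
  infer_instance

/-! ### Functions with vanishing trace -/

theorem lintegral_enorm_mul_le {α : Type*} [MeasurableSpace α] {μ : Measure α} {f g : α → ℂ}
    (hf : AEStronglyMeasurable f μ) (hg : AEStronglyMeasurable g μ) :
    ∫⁻ x, ‖f x * g x‖ₑ ∂μ ≤ eLpNorm f 2 μ * eLpNorm g 2 μ := by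
  have h := eLpNorm_smul_le_mul_eLpNorm (r := 1) (p := 2) (q := 2) hg hf
  rwa [eLpNorm_one_eq_lintegral_enorm] at h

/-- Integrals against an `L²` function are continuous with respect to `L²` convergence. -/
theorem tendsto_integral_mul_of_tendsto_eLpNorm {α : Type*} [MeasurableSpace α] {μ : Measure α}
    {u : ℕ → α → ℂ} {f k : α → ℂ} (hu : ∀ n, AEStronglyMeasurable (u n) μ) (hf : MemLp f 2 μ)
    (hk : MemLp k 2 μ) (h : Tendsto (fun n => eLpNorm (fun x => u n x - f x) 2 μ) atTop (𝓝 0)) :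
    Tendsto (fun n => ∫ x, u n x * k x ∂μ) atTop (𝓝 (∫ x, f x * k x ∂μ)) := by
  have hsub : ∀ n, AEStronglyMeasurable (fun x => u n x - f x) μ := fun n =>
    (hu n).sub hf.aestronglyMeasurable
  refine tendsto_integral_of_L1' _ (hf.aestronglyMeasurable.mul hk.aestronglyMeasurable) ?_ ?_
  · filter_upwards [h.eventually (gt_mem_nhds ENNReal.zero_lt_top)] with n hn
    have h1 : MemLp (fun x => u n x - f x) 2 μ := ⟨hsub n, hn⟩
    have h2 : MemLp (u n) 2 μ := by
      have h3 := h1.add hf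
      rwa [show (fun x => u n x - f x) + f = u n by ext; simp] at h3
    exact h2.integrable_mul hk
  · have h1 : Tendsto (fun n => eLpNorm (fun x => u n x - f x) 2 μ * eLpNorm k 2 μ) atTop
        (𝓝 0) := by
      simpa using ENNReal.Tendsto.mul_const h (Or.inr hk.eLpNorm_ne_top)
    refine tendsto_of_tendsto_of_tendsto_of_le_of_le tendsto_const_nhds h1 (fun _ => zero_le)
      fun n => ?_
    have h2 := eLpNorm_smul_le_mul_eLpNorm (r := 1) (p := 2) (q := 2) hk.aestronglyMeasurable
      (hsub n)
    rwa [show (fun x => u n x - f x) • k = (fun x => u n x * k x) - fun x => f x * k x by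
      ext; simp [sub_mul]] at h2

theorem IsTestFunction.partialDeriv {d : ℕ} {φ : Space d → ℂ} (hφ : IsTestFunction φ) (i : Fin d) :
    IsTestFunction (partialDeriv φ i) :=
  ⟨(hφ.1.fderiv_right (m := ∞) (by simp)).clm_apply contDiff_const, hφ.2.fderiv_apply (𝕜 := ℝ) _⟩

theorem IsTestFunction.memLp {d : ℕ} {φ : Space d → ℂ} (hφ : IsTestFunction φ)
    (μ : Measure (Space d)) [IsFiniteMeasureOnCompacts μ] : MemLp φ 2 μ :=
  hφ.1.continuous.memLp_of_hasCompactSupport hφ.2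

theorem continuous_partialDeriv {d : ℕ} {φ : Space d → ℂ} (hφ : ContDiff ℝ ∞ φ) (i : Fin d) :
    Continuous (partialDeriv φ i) :=
  (hφ.continuous_fderiv (by simp)).clm_apply continuous_const

/-- A function with vanishing trace may be integrated by parts against every test function, without
boundary terms; in other words, its extension by zero is weakly differentiable. -/
theorem integral_mul_partialDeriv_of_trace_zero {d : ℕ} (hd : 2 ≤ d) {D : Set (Space d)}
    (hD : IsOpen D) (hb : Bornology.IsBounded D) (hC : HasC2Boundary D) {ψ : Space d → ℂ}
    {G : Fin d → Space d → ℂ} {g : Space d → ℂ} (hψ : IsSobolevWithGradient D ψ G)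
    (hg : IsTrace D ψ G g) (hg0 : g =ᵐ[surfaceMeasure D] 0) {χ : Space d → ℂ}
    (hχ : IsTestFunction χ) (i : Fin d) :
    ∫ x, ψ x * partialDeriv χ i x ∂(volumeOn D) = - ∫ x, G i x * χ x ∂(volumeOn D) := by
  have hfinS := isFiniteMeasure_surfaceMeasure hD hb hC
  have hfinV : IsFiniteMeasure (volumeOn D) :=
    ⟨by simpa [volumeOn] using hb.measure_lt_top⟩
  obtain ⟨u, hu, hu0, hu1, hus⟩ := hg.approx
  obtain ⟨C, hCtop, hCle⟩ := enorm_setIntegral_fderiv_le d hd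
  obtain ⟨k, hk0, hk⟩ := exists_lintegral_frontier_le D
  have hlim0 := tendsto_integral_mul_of_tendsto_eLpNorm
    (fun n => (hu n).continuous.aestronglyMeasurable) hψ.memLp
    ((hχ.partialDeriv i).memLp (volumeOn D)) hu0
  have hlim1 := tendsto_integral_mul_of_tendsto_eLpNorm
    (fun n => (continuous_partialDeriv (hu n) i).aestronglyMeasurable) (hψ.memLp_grad i)
    (hχ.memLp (volumeOn D)) (hu1 i)
  have hsum : ∀ n, ∫ x, u n x * partialDeriv χ i x ∂(volumeOn D) +
      ∫ x, partialDeriv (u n) i x * χ x ∂(volumeOn D) =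
      ∫ x in D, fderiv ℝ (fun x => u n x * χ x) x (EuclideanSpace.single i 1) := by
    intro n
    rw [← integral_add]
    · refine integral_congr_ae (ae_of_all _ fun x => ?_)
      simp only [partialDeriv]
      rw [fderiv_fun_mul (((hu n).differentiable (by simp)) x)
        ((hχ.1.differentiable (by simp)) x)]
      simp [mul_comm]
    · exact integrableOn_of_continuous hb
        ((hu n).continuous.mul (continuous_partialDeriv hχ.1 i))
    · exact integrableOn_of_continuous hb
        ((continuous_partialDeriv (hu n) i).mul hχ.1.continuous)
  have hus' : Tendsto (fun n => eLpNorm (u n) 2 (surfaceMeasure D)) atTop (𝓝 0) := by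
    refine hus.congr fun n => eLpNorm_congr_ae ?_
    filter_upwards [hg0] with x hx
    simp [hx]
  have hbd : ∀ n, ‖∫ x in D, fderiv ℝ (fun x => u n x * χ x) x (EuclideanSpace.single i 1)‖ₑ ≤
      C * k * (eLpNorm (u n) 2 (surfaceMeasure D) *
        eLpNorm χ 2 (surfaceMeasure D)) := by
    intro n
    refine (hCle hD hb (hausdorffMeasure_frontier_ne_top hD hb hC)
      (((hu n).mul hχ.1).of_le (by simp)) hχ.2.mul_left (by simp)).trans ?_
    rw [mul_assoc]
    gcongr
    refine (hk _).trans ?_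
    gcongr
    exact lintegral_enorm_mul_le (hu n).continuous.aestronglyMeasurable
      hχ.1.continuous.aestronglyMeasurable
  have hlim : Tendsto (fun n => ∫ x in D, fderiv ℝ (fun x => u n x * χ x) x
      (EuclideanSpace.single i 1)) atTop (𝓝 0) := by
    rw [tendsto_zero_iff_enorm_tendsto_zero]
    have h2 : Tendsto (fun n => C * k * (eLpNorm (u n) 2 (surfaceMeasure D) *
        eLpNorm χ 2 (surfaceMeasure D))) atTop (𝓝 0) := by
      have h3 := ENNReal.Tendsto.const_mul (a := C * k) (ENNReal.Tendsto.mul_const hus'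
        (Or.inr (hχ.memLp (surfaceMeasure D)).eLpNorm_ne_top))
        (Or.inr (ENNReal.mul_ne_top hCtop hk0))
      simpa using h3
    exact tendsto_of_tendsto_of_tendsto_of_le_of_le tendsto_const_nhds h2 (fun _ => zero_le) hbd
  have h4 := (hlim0.add hlim1).congr hsum
  exact eq_neg_of_add_eq_zero_left (tendsto_nhds_unique h4 hlim)

/-! ### Fourier series on a cube -/

section Parseval

-- The Fourier basis of the torus is defined with respect to the normalised Haar measure.
noncomputable local instance : MeasureSpace UnitAddCircle := ⟨AddCircle.haarAddCircle⟩

variable {ι : Type*}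

/-- The unit cube centred at the origin. -/
def unitCube (ι : Type*) : Set (ι → ℝ) :=
  {x | ∀ i, x i ∈ Ioc (-(1 / 2) : ℝ) (-(1 / 2) + 1)}

theorem measurableSet_unitCube [Fintype ι] : MeasurableSet (unitCube ι) :=
  MeasurableSet.univ_pi' fun _ => measurableSet_Ioc

/-- The representative in the unit cube of a point of the torus. -/
noncomputable def torusLift (t : UnitAddTorus ι) : ι → ℝ :=
  (UnitAddTorus.measurableEquivPiIoc (fun _ : ι => -(1 / 2 : ℝ)) t).1

theorem measurePreserving_torusLift [Fintype ι] :
    MeasurePreserving (torusLift (ι := ι)) volume (volume.restrict (unitCube ι)) :=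
  (measurePreserving_subtype_coe measurableSet_unitCube).comp
    (UnitAddTorus.measurePreserving_equivPiIoc fun _ : ι => -(1 / 2 : ℝ))

theorem torusLift_coe {x : ι → ℝ} (hx : x ∈ unitCube ι) :
    torusLift (fun i => (x i : UnitAddCircle)) = x := by
  have h := (UnitAddTorus.measurableEquivPiIoc (fun _ : ι => -(1 / 2 : ℝ))).apply_symm_apply ⟨x, hx⟩
  exact congrArg Subtype.val h

/-- Parseval's identity for the Fourier series of an `L²` function on the unit cube. -/
theorem hasSum_sq_fourier_unitCube [Fintype ι] {F : (ι → ℝ) → ℂ}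
    (hF : MemLp F 2 (volume.restrict (unitCube ι))) :
    HasSum (fun n : ι → ℤ => ‖∫ x in unitCube ι,
      UnitAddTorus.mFourier (-n) (fun i => (x i : UnitAddCircle)) * F x‖ ^ 2)
      (∫ x in unitCube ι, ‖F x‖ ^ 2) := by
  have hmp := measurePreserving_torusLift (ι := ι)
  have hf : MemLp (F ∘ torusLift) 2 (volume : Measure (UnitAddTorus ι)) :=
    hF.comp_measurePreserving hmp
  have h := UnitAddTorus.hasSum_sq_mFourierCoeff (hf.toLp _)
  have hae := hf.coeFn_toLp
  have h1 : ∀ n, UnitAddTorus.mFourierCoeff (hf.toLp _) n = ∫ x in unitCube ι,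
      UnitAddTorus.mFourier (-n) (fun i => (x i : UnitAddCircle)) * F x := by
    intro n
    rw [UnitAddTorus.mFourierCoeff]
    trans ∫ t, UnitAddTorus.mFourier (-n) t • (F ∘ torusLift) t
    · refine integral_congr_ae ?_
      filter_upwards [hae] with t ht
      rw [ht]
    · rw [UnitAddTorus.integral_preimage _ (fun _ : ι => -(1 / 2 : ℝ))]
      refine setIntegral_congr_fun measurableSet_unitCube fun x hx => ?_
      simp [torusLift_coe hx]
  have h2 : ∫ t, ‖(hf.toLp _) t‖ ^ 2 = ∫ x in unitCube ι, ‖F x‖ ^ 2 := by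
    trans ∫ t, ‖(F ∘ torusLift) t‖ ^ 2
    · refine integral_congr_ae ?_
      filter_upwards [hae] with t ht
      rw [ht]
    · rw [UnitAddTorus.integral_preimage _ (fun _ : ι => -(1 / 2 : ℝ))]
      refine setIntegral_congr_fun measurableSet_unitCube fun x hx => ?_
      simp [torusLift_coe hx]
  simp only [h1, h2] at h
  exact h

end Parseval

/-! ### Unique continuation -/

/-- The exponential `x ↦ exp (ζ · x)` with complex frequency `ζ`. -/
noncomputable def expDot {d : ℕ} (ζ : Fin d → ℂ) (x : Space d) : ℂ := Complex.exp (∑ j, ζ j * x j)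

theorem contDiff_expDot {d : ℕ} (ζ : Fin d → ℂ) : ContDiff ℝ ∞ (expDot ζ) := by
  have h : ContDiff ℝ ∞ fun x : Space d => ∑ j, ζ j * ((x j : ℝ) : ℂ) := by
    refine ContDiff.sum fun j _ => contDiff_const.mul ?_
    exact Complex.ofRealCLM.contDiff.comp (EuclideanSpace.proj (𝕜 := ℝ) j).contDiff
  exact Complex.contDiff_exp.comp h

theorem partialDeriv_expDot {d : ℕ} (ζ : Fin d → ℂ) (i : Fin d) :
    partialDeriv (expDot ζ) i = fun x => ζ i * expDot ζ x := by
  ext x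
  have h : HasFDerivAt (fun x : Space d => ∑ j, ζ j * ((x j : ℝ) : ℂ))
      (∑ j, ζ j • Complex.ofRealCLM.comp (EuclideanSpace.proj (𝕜 := ℝ) j)) x := by
    refine HasFDerivAt.fun_sum fun j _ => ?_
    exact (Complex.ofRealCLM.hasFDerivAt.comp x
      (EuclideanSpace.proj (𝕜 := ℝ) j).hasFDerivAt).const_mul (ζ j)
  have h2 := h.cexp
  rw [partialDeriv, HasFDerivAt.fderiv (f := expDot ζ) h2]
  have h3 : ∑ j, ζ j * (((EuclideanSpace.single i (1 : ℝ) : Space d) j : ℝ) : ℂ) = ζ i := by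
    rw [Finset.sum_eq_single i] <;> simp +contextual
  simp only [_root_.smul_apply, _root_.sum_apply, ContinuousLinearMap.comp_apply,
    Complex.ofRealCLM_apply, smul_eq_mul]
  rw [show ∑ j, ζ j * ((EuclideanSpace.proj (𝕜 := ℝ) j (EuclideanSpace.single i (1 : ℝ)) : ℝ) : ℂ) =
    ζ i from h3, mul_comm, expDot]

theorem expDot_add {d : ℕ} (ζ η : Fin d → ℂ) (x : Space d) :
    expDot (ζ + η) x = expDot ζ x * expDot η x := by
  simp [expDot, add_mul, Finset.sum_add_distrib, Complex.exp_add]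

/-- Functions supported in a cube can be compared in `L²` by comparing their Fourier coefficients
with respect to the lattice that belongs to the cube. -/
theorem integral_norm_sq_le_of_fourier_le {d : ℕ} {ℓ : ℝ} (hℓ : 0 < ℓ) {A B : Space d → ℂ}
    (hA : MemLp A 2 volume) (hB : MemLp B 2 volume) (hA0 : ∀ x ∉ ball 0 (ℓ / 2), A x = 0)
    (hB0 : ∀ x ∉ ball 0 (ℓ / 2), B x = 0) {c : ℝ}
    (hle : ∀ n : Fin d → ℤ,
      ‖∫ x, expDot (fun j => -(2 * Real.pi * n j / ℓ) * Complex.I) x * A x‖ ≤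
        c * ‖∫ x, expDot (fun j => -(2 * Real.pi * n j / ℓ) * Complex.I) x * B x‖) :
    ∫ x, ‖A x‖ ^ 2 ≤ c ^ 2 * ∫ x, ‖B x‖ ^ 2 := by
  set s : ℝ := |(ℓ ^ d)⁻¹| with hs
  have hs0 : 0 < s := by positivity
  have hsc : ∀ {F : Type} [NormedAddCommGroup F] [NormedSpace ℝ F] (g : Space d → F),
      ∫ y : Fin d → ℝ, g (ℓ • WithLp.toLp 2 y) = s • ∫ x, g x := by
    intro F _ _ g
    rw [(PiLp.volume_preserving_toLp (Fin d)).integral_comp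
      (MeasurableEquiv.toLp 2 (Fin d → ℝ)).measurableEmbedding fun x : Space d => g (ℓ • x),
      Measure.integral_comp_smul, finrank_euclideanSpace,
      Fintype.card_fin]
  have hcube : ∀ {g : Space d → ℂ}, (∀ x ∉ ball 0 (ℓ / 2), g x = 0) →
      ∀ y ∉ unitCube (Fin d), g (ℓ • WithLp.toLp 2 y) = 0 := by
    intro g hg y hy
    refine hg _ fun hmem => hy fun i => ?_
    rw [mem_ball_zero_iff, norm_smul, Real.norm_of_nonneg hℓ.le] at hmem
    have h1 : |y i| ≤ ‖WithLp.toLp 2 y‖ := PiLp.norm_apply_le (WithLp.toLp 2 y : Space d) i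
    have h2 : |y i| < 1 / 2 := by nlinarith
    rw [abs_lt] at h2
    constructor <;> linarith
  have hmem : ∀ {g : Space d → ℂ}, MemLp g 2 volume →
      MemLp (fun y : Fin d → ℝ => g (ℓ • WithLp.toLp 2 y)) 2 (volume.restrict (unitCube (Fin d))) := by
    intro g hg
    have h1 : MemLp g 2 (Measure.map (fun x : Space d => ℓ • x) volume) := by
      rw [Measure.map_addHaar_smul _ hℓ.ne']
      exact hg.smul_measure ENNReal.ofReal_ne_top
    have h2 := h1.comp_of_map (by fun_prop)
    exact (h2.comp_measurePreserving (PiLp.volume_preserving_toLp (Fin d))).restrict _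
  have hcoef : ∀ {g : Space d → ℂ}, (∀ x ∉ ball 0 (ℓ / 2), g x = 0) → ∀ n : Fin d → ℤ,
      ∫ y in unitCube (Fin d), UnitAddTorus.mFourier (-n) (fun i => (y i : UnitAddCircle)) *
        g (ℓ • WithLp.toLp 2 y) =
      s • ∫ x, expDot (fun j => -(2 * Real.pi * n j / ℓ) * Complex.I) x * g x := by
    intro g hg n
    rw [← hsc, setIntegral_eq_integral_of_forall_compl_eq_zero]
    · refine integral_congr_ae (ae_of_all _ fun y => ?_)
      dsimp only
      congr 1
      simp only [UnitAddTorus.mFourier, ContinuousMap.coe_mk, fourier_coe_apply, expDot,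
        ← Complex.exp_sum]
      congr 1
      refine Finset.sum_congr rfl fun j _ => ?_
      have : (ℓ : ℂ) ≠ 0 := by exact_mod_cast hℓ.ne'
      simp
      field_simp
    · intro y hy
      rw [hcube hg y hy, mul_zero]
  have hnorm : ∀ {g : Space d → ℂ}, (∀ x ∉ ball 0 (ℓ / 2), g x = 0) →
      ∫ y in unitCube (Fin d), ‖g (ℓ • WithLp.toLp 2 y)‖ ^ 2 = s * ∫ x, ‖g x‖ ^ 2 := by
    intro g hg
    rw [← smul_eq_mul, ← hsc, setIntegral_eq_integral_of_forall_compl_eq_zero]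
    intro y hy
    rw [hcube hg y hy]
    simp
  have hPA := hasSum_sq_fourier_unitCube (hmem hA)
  have hPB := (hasSum_sq_fourier_unitCube (hmem hB)).mul_left (c ^ 2)
  rw [hnorm hA0] at hPA
  rw [hnorm hB0] at hPB
  have := hasSum_le (fun n => ?_) hPA hPB
  · nlinarith
  · rw [hcoef hA0, hcoef hB0, norm_smul, norm_smul, mul_pow, mul_pow, mul_left_comm, ← mul_pow c]
    gcongr
    exact hle n

/-- A weak solution of `Δψ = f` whose extension by zero is still a weak solution can be tested with
arbitrary exponentials. -/
theorem mul_integral_expDot_eq {d : ℕ} {D : Set (Space d)} (hb : Bornology.IsBounded D)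
    (hDm : MeasurableSet D) {ψ f : Space d → ℂ}
    (h : ∀ φ : Space d → ℂ, IsTestFunction φ →
      ∫ x, ψ x * ∑ i, partialDeriv (partialDeriv φ i) i x ∂(volumeOn D) =
        ∫ x, f x * φ x ∂(volumeOn D)) (ζ : Fin d → ℂ) :
    (∑ i, ζ i ^ 2) * ∫ x in D, expDot ζ x * ψ x = ∫ x in D, expDot ζ x * f x := by
  obtain ⟨R, hR⟩ := hb.subset_ball (0 : Space d)
  have hR0 : 0 < max R 1 := by positivity
  let b : ContDiffBump (0 : Space d) := ⟨max R 1, max R 1 + 1, hR0, by linarith⟩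
  set φ : Space d → ℂ := fun x => (b x : ℂ) * expDot ζ x with hφ
  have hφt : IsTestFunction φ := by
    refine ⟨(Complex.ofRealCLM.contDiff.comp b.contDiff).mul (contDiff_expDot ζ), ?_⟩
    exact HasCompactSupport.mul_right (b.hasCompactSupport.comp_left (g := Complex.ofReal) (by simp))
  have hloc : ∀ x ∈ D, φ =ᶠ[𝓝 x] expDot ζ := fun x hx => by
    filter_upwards [isOpen_ball.mem_nhds (ball_subset_ball (le_max_left R 1) (hR hx))] with y hy
    simp [hφ, b.one_of_mem_closedBall (ball_subset_closedBall hy)]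
  have hlap : ∀ x ∈ D, ∑ i, partialDeriv (partialDeriv φ i) i x =
      (∑ i, ζ i ^ 2) * expDot ζ x := by
    intro x hx
    rw [Finset.sum_mul]
    refine Finset.sum_congr rfl fun i _ => ?_
    have h1 : partialDeriv φ i =ᶠ[𝓝 x] fun y => ζ i * expDot ζ y := by
      filter_upwards [(hloc x hx).eventuallyEq_nhds] with y hy
      rw [partialDeriv, hy.fderiv_eq]
      exact congrFun (partialDeriv_expDot ζ i) y
    rw [partialDeriv, h1.fderiv_eq,
      fderiv_const_mul (((contDiff_expDot ζ).differentiable (by simp)) x)]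
    have h2 := congrFun (partialDeriv_expDot ζ i) x
    rw [partialDeriv] at h2
    rw [_root_.smul_apply, h2, smul_eq_mul]
    ring
  have h3 := h φ hφt
  rw [volumeOn] at h3
  rw [← integral_const_mul]
  calc _ = ∫ x in D, ψ x * ∑ i, partialDeriv (partialDeriv φ i) i x :=
        setIntegral_congr_fun hDm fun x hx => by
          rw [hlap x hx]
          ring
    _ = ∫ x in D, f x * φ x := h3
    _ = _ := setIntegral_congr_fun hDm fun x hx => by
          rw [(hloc x hx).self_of_nhds]
          ring

/-- **Unique continuation.** If the extension of `ψ` by zero outside a bounded set solves `Δψ = f`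
on the whole space and `|f| ≤ M |ψ|`, then `ψ = 0`. After multiplication by `exp (τ x₁ - iπ x₁ / ℓ)`,
the Fourier coefficients of `f` on a cube of side `ℓ` are those of `ψ` times numbers of absolute
value at least `2πτ / ℓ`; for large `τ` this is incompatible with `|f| ≤ M |ψ|` unless `ψ = 0`. -/
theorem ae_eq_zero_of_weak_laplacian_le {d : ℕ} (hd : 0 < d) {D : Set (Space d)}
    (hb : Bornology.IsBounded D) (hDm : MeasurableSet D) {ψ f : Space d → ℂ}
    (hψ : MemLp ψ 2 (volumeOn D)) (hf : MemLp f 2 (volumeOn D)) {M : ℝ}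
    (hfψ : ∀ᵐ x ∂(volumeOn D), ‖f x‖ ≤ M * ‖ψ x‖)
    (h : ∀ φ : Space d → ℂ, IsTestFunction φ →
      ∫ x, ψ x * ∑ i, partialDeriv (partialDeriv φ i) i x ∂(volumeOn D) =
        ∫ x, f x * φ x ∂(volumeOn D)) :
    ψ =ᵐ[volumeOn D] 0 := by
  obtain ⟨R, hR0, hR⟩ := hb.subset_ball_lt 0 (0 : Space d)
  set ℓ : ℝ := 2 * R with hℓ
  have hℓ0 : 0 < ℓ := by positivity
  have hRℓ : ℓ / 2 = R := by rw [hℓ]; ring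
  -- With this choice, the factor `2πτ / ℓ` gained in each Fourier coefficient is `|M| + 1`.
  set τ : ℝ := ℓ * (|M| + 1) / (2 * Real.pi) with hτ
  have hτ0 : 0 < τ := by positivity
  set i₀ : Fin d := ⟨0, hd⟩ with hi₀
  set η : Fin d → ℂ := Pi.single i₀ ((τ : ℂ) - (Real.pi / ℓ : ℝ) * Complex.I) with hη
  have hmem : ∀ {g : Space d → ℂ}, MemLp g 2 (volumeOn D) →
      MemLp (D.indicator fun x => expDot η x * g x) 2 volume := by
    intro g hg
    rw [memLp_indicator_iff_restrict hDm]
    obtain ⟨C, hC⟩ := hb.isCompact_closure.exists_bound_of_continuousOn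
      (contDiff_expDot η).continuous.continuousOn
    refine MemLp.of_le_mul (c := C) hg
      ((contDiff_expDot η).continuous.aestronglyMeasurable.mul hg.aestronglyMeasurable) ?_
    refine (ae_restrict_iff' hDm).2 (ae_of_all _ fun x hx => ?_)
    rw [norm_mul]
    gcongr
    exact hC x (subset_closure hx)
  have hsupp : ∀ (g : Space d → ℂ), ∀ x ∉ ball (0 : Space d) (ℓ / 2), D.indicator g x = 0 :=
    fun g x hx => indicator_of_notMem (fun hxD => hx (hRℓ ▸ hR hxD)) _
  have hcoef : ∀ (g : Space d → ℂ) (n : Fin d → ℤ),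
      ∫ x, expDot (fun j => -(2 * Real.pi * n j / ℓ) * Complex.I) x *
        D.indicator (fun x => expDot η x * g x) x =
      ∫ x in D, expDot ((fun j => -(2 * Real.pi * n j / ℓ) * Complex.I) + η) x * g x := by
    intro g n
    rw [← integral_indicator hDm]
    congr 1 with x
    by_cases hx : x ∈ D
    · simp only [indicator_of_mem hx]
      rw [expDot_add, mul_assoc]
    · simp [indicator_of_notMem hx]
  have hsymb : ∀ n : Fin d → ℤ, |M| + 1 ≤
      ‖∑ i, (((fun j => -(2 * Real.pi * n j / ℓ) * Complex.I) + η : Fin d → ℂ) i) ^ 2‖ := by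
    intro n
    -- The imaginary part comes from the first coordinate alone; the shift by half a period keeps
    -- the odd number `2 n + 1` away from zero.
    have him : (∑ i, (((fun j => -(2 * Real.pi * n j / ℓ) * Complex.I) + η : Fin d → ℂ) i) ^ 2).im =
        -(2 * τ * (Real.pi / ℓ) * ((2 * n i₀ + 1 : ℤ) : ℝ)) := by
      rw [Complex.im_sum, Finset.sum_eq_single i₀]
      · have : (((fun j => -(2 * Real.pi * n j / ℓ) * Complex.I) + η : Fin d → ℂ) i₀) =
            (τ : ℂ) - ((Real.pi / ℓ * (2 * n i₀ + 1) : ℝ) : ℂ) * Complex.I := by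
          simp [hη]
          ring
        rw [this, sq, Complex.mul_im]
        simp
        ring
      · intro j _ hj
        have : (((fun j => -(2 * Real.pi * n j / ℓ) * Complex.I) + η : Fin d → ℂ) j) =
            ((-(2 * Real.pi * n j / ℓ) : ℝ) : ℂ) * Complex.I := by
          simp [hη, hj]
        rw [this, mul_pow, Complex.I_sq, ← Complex.ofReal_pow, mul_neg_one, Complex.neg_im,
          Complex.ofReal_im, neg_zero]
      · simp
    have hodd : (1 : ℝ) ≤ |((2 * n i₀ + 1 : ℤ) : ℝ)| := by
      rw [← Int.cast_abs]
      exact_mod_cast Int.one_le_abs (by omega)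
    have hc : 2 * τ * (Real.pi / ℓ) = |M| + 1 := by
      rw [hτ]
      field_simp
    calc |M| + 1 ≤ (|M| + 1) * |((2 * n i₀ + 1 : ℤ) : ℝ)| :=
          le_mul_of_one_le_right (by positivity) hodd
      _ = |-(2 * τ * (Real.pi / ℓ) * ((2 * n i₀ + 1 : ℤ) : ℝ))| := by
          rw [abs_neg, abs_mul, hc, abs_of_pos (by positivity : 0 < |M| + 1)]
      _ ≤ _ := by
          rw [← him]
          exact Complex.abs_im_le_norm _
  have hle := integral_norm_sq_le_of_fourier_le hℓ0 (hmem hψ) (hmem hf) (hsupp _) (hsupp _)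
    (c := (|M| + 1)⁻¹) (fun n => by
      rw [hcoef, hcoef, ← mul_integral_expDot_eq hb hDm h, norm_mul,
        le_inv_mul_iff₀ (by positivity)]
      gcongr
      exact hsymb n)
  have hle2 : ∫ x, ‖D.indicator (fun x => expDot η x * f x) x‖ ^ 2 ≤
      |M| ^ 2 * ∫ x, ‖D.indicator (fun x => expDot η x * ψ x) x‖ ^ 2 := by
    rw [← integral_const_mul]
    refine integral_mono_ae ((hmem hf).integrable_norm_pow two_ne_zero)
      (((hmem hψ).integrable_norm_pow two_ne_zero).const_mul _) ?_
    filter_upwards [(ae_restrict_iff' hDm).1 hfψ] with x hx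
    by_cases hxD : x ∈ D
    · simp only [indicator_of_mem hxD]
      rw [← mul_pow, norm_mul, norm_mul, mul_left_comm]
      gcongr
      exact (hx hxD).trans (by gcongr; exact le_abs_self M)
    · simp [indicator_of_notMem hxD]
  have hzero : ∫ x, ‖D.indicator (fun x => expDot η x * ψ x) x‖ ^ 2 = 0 := by
    set I := ∫ x, ‖D.indicator (fun x => expDot η x * ψ x) x‖ ^ 2 with hI
    have hI0 : 0 ≤ I := integral_nonneg fun x => by positivity
    have h1 : (|M| + 1) ^ 2 * I ≤ |M| ^ 2 * I := by
      have h2 : I ≤ (|M| + 1)⁻¹ ^ 2 * (|M| ^ 2 * I) := hle.trans (by gcongr)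
      rwa [inv_pow, le_inv_mul_iff₀ (by positivity)] at h2
    nlinarith [abs_nonneg M]
  rw [integral_eq_zero_iff_of_nonneg (fun x => by positivity)
    ((hmem hψ).integrable_norm_pow two_ne_zero)] at hzero
  refine (ae_restrict_iff' hDm).2 ?_
  filter_upwards [hzero] with x hx hxD
  simpa [indicator_of_mem hxD, expDot] using hx

/-! ### Solutions and complex conjugation -/

/-- `ψ`, with weak gradient `G`, weak Laplacian `f`, trace `g` and normal derivative `h`, satisfies
every condition on an eigenfunction except that of being nonzero. -/
structure IsSolution {d : ℕ} (D : Set (Space d)) (v : Space d → ℝ) (α E : ℝ) (ψ : Space d → ℂ)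
    (G : Fin d → Space d → ℂ) (f g h : Space d → ℂ) : Prop where
  sobolev : IsSobolevWithGradient D ψ G
  laplacian : IsWeakLaplacian D G f
  trace : IsTrace D ψ G g
  normalDeriv : IsNormalDerivative D G f h
  equation : ∀ᵐ x ∂(volumeOn D), - f x + (v x : ℂ) * ψ x = (E : ℂ) * ψ x
  boundary : ∀ᵐ x ∂(surfaceMeasure D), (Real.cos α : ℂ) * g x - (Real.sin α : ℂ) * h x = 0

section Conj

variable {d : ℕ} {D : Set (Space d)}

theorem partialDeriv_conj {φ : Space d → ℂ} (i : Fin d) (x : Space d) :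
    partialDeriv (fun y => conj (φ y)) i x = conj (partialDeriv φ i x) := by
  have h : fderiv ℝ (fun y => conj (φ y)) x =
      (Complex.conjCLE : ℂ →L[ℝ] ℂ).comp (fderiv ℝ φ x) :=
    Complex.conjCLE.comp_fderiv (f := φ) (x := x)
  rw [partialDeriv, h]
  rfl

theorem IsTestFunction.conj {φ : Space d → ℂ} (hφ : IsTestFunction φ) :
    IsTestFunction fun x => conj (φ x) :=
  ⟨Complex.conjCLE.contDiff.comp hφ.1, hφ.2.comp_left (g := fun z : ℂ => conj z) (by simp)⟩

theorem memLp_conj {μ : Measure (Space d)} {f : Space d → ℂ} (hf : MemLp f 2 μ) :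
    MemLp (fun x => conj (f x)) 2 μ :=
  hf.congr_norm (Complex.continuous_conj.comp_aestronglyMeasurable hf.aestronglyMeasurable)
    (ae_of_all _ fun x => by simp)

theorem IsTrace.conj {ψ : Space d → ℂ} {G : Fin d → Space d → ℂ} {g : Space d → ℂ}
    (h : IsTrace D ψ G g) :
    IsTrace D (fun x => conj (ψ x)) (fun i x => conj (G i x)) (fun x => conj (g x)) := by
  obtain ⟨u, hu, h0, h1, hs⟩ := h.approx
  have key : ∀ (a b : Space d → ℂ) (μ : Measure (Space d)),
      eLpNorm (fun x => conj (a x) - conj (b x)) 2 μ = eLpNorm (fun x => a x - b x) 2 μ :=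
    fun a b μ => eLpNorm_congr_norm_ae (ae_of_all _ fun x => by
      rw [← map_sub, RCLike.norm_conj])
  refine ⟨memLp_conj h.memLp, fun n x => conj (u n x), fun n => Complex.conjCLE.contDiff.comp (hu n),
    ?_, fun i => ?_, ?_⟩
  · simpa only [key] using h0
  · simpa only [partialDeriv_conj, key] using h1 i
  · simpa only [key] using hs

theorem IsNormalDerivative.conj {G : Fin d → Space d → ℂ} {f h : Space d → ℂ}
    (hh : IsNormalDerivative D G f h) :
    IsNormalDerivative D (fun i x => conj (G i x)) (fun x => conj (f x)) fun x => conj (h x) := by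
  refine ⟨memLp_conj hh.memLp, fun φ hφ => ?_⟩
  have h1 := congrArg (starRingEnd ℂ) (hh.green _ hφ.conj)
  rw [← integral_conj, ← integral_conj] at h1
  simpa [partialDeriv_conj] using h1

end Conj

/-! ### Green's formulas -/

section Green

variable {d : ℕ} {D : Set (Space d)}

/-- Green's formula with functions that are smooth up to the boundary, instead of compactly
supported ones. -/
theorem IsNormalDerivative.green_of_contDiff (hb : Bornology.IsBounded D) (hDm : MeasurableSet D)
    {G : Fin d → Space d → ℂ} {f h : Space d → ℂ} (hh : IsNormalDerivative D G f h)
    {u : Space d → ℂ} (hu : ContDiff ℝ ∞ u) :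
    ∫ x, ((∑ i, G i x * partialDeriv u i x) + f x * u x) ∂(volumeOn D) =
      ∫ x, h x * u x ∂(surfaceMeasure D) := by
  obtain ⟨R, hR0, hR⟩ := hb.closure.subset_ball_lt 0 (0 : Space d)
  let b : ContDiffBump (0 : Space d) := ⟨R, R + 1, hR0, by linarith⟩
  set φ : Space d → ℂ := fun x => (b x : ℂ) * u x with hφ
  have hφt : IsTestFunction φ := by
    refine ⟨(Complex.ofRealCLM.contDiff.comp b.contDiff).mul hu, ?_⟩
    exact HasCompactSupport.mul_right (b.hasCompactSupport.comp_left (g := Complex.ofReal) (by simp))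
  have hloc : ∀ x ∈ closure D, φ =ᶠ[𝓝 x] u := fun x hx => by
    filter_upwards [isOpen_ball.mem_nhds (hR hx)] with y hy
    simp [hφ, b.one_of_mem_closedBall (ball_subset_closedBall hy)]
  have h1 := hh.green φ hφt
  rw [volumeOn, surfaceMeasure] at h1 ⊢
  rw [setIntegral_congr_fun hDm (g := fun x => (∑ i, G i x * partialDeriv u i x) + f x * u x)
    (fun x hx => ?_), setIntegral_congr_fun isClosed_frontier.measurableSet
    (g := fun x => h x * u x) (fun x hx => ?_)] at h1
  · exact h1
  · simp only [(hloc x (frontier_subset_closure hx)).self_of_nhds]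
  · have h2 := hloc x (subset_closure hx)
    simp only [h2.self_of_nhds, partialDeriv, h2.fderiv_eq]

theorem memLp_of_continuous (hb : Bornology.IsBounded D) {u : Space d → ℂ}
    (hu : Continuous u) : MemLp u 2 (volumeOn D) := by
  have : IsFiniteMeasure (volumeOn D) := ⟨by simpa [volumeOn] using hb.measure_lt_top⟩
  obtain ⟨C, hC⟩ := hb.isCompact_closure.exists_bound_of_continuousOn hu.continuousOn
  have hae : ∀ᵐ x ∂(volumeOn D), ‖u x‖ ≤ C := by
    refine ae_restrict_of_ae_restrict_of_subset subset_closure ?_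
    exact (ae_restrict_iff' isClosed_closure.measurableSet).2 (ae_of_all _ hC)
  exact MemLp.of_bound hu.aestronglyMeasurable C hae

/-- Green's first formula for a function with a trace and a function with a normal derivative. -/
theorem green_formula (hb : Bornology.IsBounded D) (hDm : MeasurableSet D)
    {ψ : Space d → ℂ} {G G' : Fin d → Space d → ℂ} {f' g h' : Space d → ℂ}
    (hψ : MemLp ψ 2 (volumeOn D))
    (hG : ∀ i, MemLp (G i) 2 (volumeOn D)) (hG' : ∀ i, MemLp (G' i) 2 (volumeOn D))
    (hf' : MemLp f' 2 (volumeOn D)) (hg : IsTrace D ψ G g) (hh' : IsNormalDerivative D G' f' h') :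
    (∑ i, ∫ x, G i x * G' i x ∂(volumeOn D)) + ∫ x, ψ x * f' x ∂(volumeOn D) =
      ∫ x, g x * h' x ∂(surfaceMeasure D) := by
  obtain ⟨u, hu, h0, h1, hs⟩ := hg.approx
  have hlim0 := tendsto_integral_mul_of_tendsto_eLpNorm
    (fun n => (hu n).continuous.aestronglyMeasurable) hψ hf' h0
  have hlim1 := tendsto_finsetSum Finset.univ fun i _ => tendsto_integral_mul_of_tendsto_eLpNorm
    (fun n => (continuous_partialDeriv (hu n) i).aestronglyMeasurable) (hG i) (hG' i) (h1 i)
  have hlims := tendsto_integral_mul_of_tendsto_eLpNorm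
    (fun n => (hu n).continuous.aestronglyMeasurable) hg.memLp hh'.memLp hs
  refine tendsto_nhds_unique ((hlim1.add hlim0).congr fun n => ?_) hlims
  have h2 := hh'.green_of_contDiff hb hDm (hu n)
  have hi1 : ∀ i, Integrable (fun x => G' i x * partialDeriv (u n) i x) (volumeOn D) := fun i =>
    (hG' i).integrable_mul (memLp_of_continuous hb (continuous_partialDeriv (hu n) i))
  have hi0 : Integrable (fun x => f' x * u n x) (volumeOn D) :=
    hf'.integrable_mul (memLp_of_continuous hb (hu n).continuous)
  rw [integral_add (integrable_finsetSum _ fun i _ => hi1 i) hi0,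
    integral_finsetSum _ fun i _ => hi1 i] at h2
  simpa only [mul_comm] using h2

end Green

/-! ### Cauchy data of solutions -/

namespace IsSolution

variable {d : ℕ} {D : Set (Space d)} {v : Space d → ℝ} {α β E : ℝ} {ψ ψ' : Space d → ℂ}
  {G G' : Fin d → Space d → ℂ} {f g h f' g' h' : Space d → ℂ}

/-- The boundary datum `k` for which the trace is `sin α • k` and the normal derivative is
`cos α • k`. -/
noncomputable def boundaryDatum (α : ℝ) (g h : Space d → ℂ) (x : Space d) : ℂ :=
  (Real.sin α : ℂ) * g x + (Real.cos α : ℂ) * h x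

theorem memLp_boundaryDatum (hs : IsSolution D v α E ψ G f g h) :
    MemLp (boundaryDatum α g h) 2 (surfaceMeasure D) :=
  (hs.trace.memLp.const_mul _).add (hs.normalDeriv.memLp.const_mul _)

theorem ae_eq_boundaryDatum (hs : IsSolution D v α E ψ G f g h) :
    ∀ᵐ x ∂(surfaceMeasure D), g x = Real.sin α * boundaryDatum α g h x ∧
      h x = Real.cos α * boundaryDatum α g h x := by
  filter_upwards [hs.boundary] with x hx
  have h1 : (Real.sin α : ℂ) ^ 2 + (Real.cos α : ℂ) ^ 2 = 1 := by
    exact_mod_cast Real.sin_sq_add_cos_sq α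
  simp only [boundaryDatum]
  constructor
  · linear_combination (-g x) * h1 + Real.cos α * hx
  · linear_combination (-h x) * h1 - Real.sin α * hx

/-- Green's second formula for two solutions of the same equation. -/
theorem integral_trace_mul_normalDeriv (hb : Bornology.IsBounded D) (hDm : MeasurableSet D)
    (hs : IsSolution D v α E ψ G f g h) (hs' : IsSolution D v β E ψ' G' f' g' h') :
    ∫ x, conj (g x) * h' x ∂(surfaceMeasure D) = ∫ x, g' x * conj (h x) ∂(surfaceMeasure D) := by
  have h1 := green_formula hb hDm (memLp_conj hs.sobolev.memLp)
    (fun i => memLp_conj (hs.sobolev.memLp_grad i)) hs'.sobolev.memLp_grad hs'.laplacian.memLp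
    hs.trace.conj hs'.normalDeriv
  have h2 := green_formula hb hDm hs'.sobolev.memLp hs'.sobolev.memLp_grad
    (fun i => memLp_conj (hs.sobolev.memLp_grad i)) (memLp_conj hs.laplacian.memLp)
    hs'.trace hs.normalDeriv.conj
  rw [← h1, ← h2]
  congr 1
  · simp only [mul_comm]
  · refine integral_congr_ae ?_
    filter_upwards [hs.equation, hs'.equation] with x hx hx'
    have e1 : f x = (v x : ℂ) * ψ x - E * ψ x := by linear_combination -hx
    have e2 : f' x = (v x : ℂ) * ψ' x - E * ψ' x := by linear_combination -hx'
    simp only [e1, e2, map_sub, map_mul, Complex.conj_ofReal]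
    ring

/-- The boundary data that belong to different boundary conditions are orthogonal. -/
theorem integral_conj_boundaryDatum_mul (hb : Bornology.IsBounded D) (hDm : MeasurableSet D)
    (hs : IsSolution D v α E ψ G f g h) (hs' : IsSolution D v β E ψ' G' f' g' h')
    (hαβ : Real.sin (α - β) ≠ 0) :
    ∫ x, conj (boundaryDatum α g h x) * boundaryDatum β g' h' x ∂(surfaceMeasure D) = 0 := by
  set I := ∫ x, conj (boundaryDatum α g h x) * boundaryDatum β g' h' x ∂(surfaceMeasure D) with hI
  have h1 : ∫ x, conj (g x) * h' x ∂(surfaceMeasure D) = (Real.sin α * Real.cos β : ℂ) * I := by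
    rw [hI, ← integral_const_mul]
    refine integral_congr_ae ?_
    filter_upwards [hs.ae_eq_boundaryDatum, hs'.ae_eq_boundaryDatum] with x hx hx'
    rw [hx.1, hx'.2, map_mul, Complex.conj_ofReal]
    ring
  have h2 : ∫ x, g' x * conj (h x) ∂(surfaceMeasure D) = (Real.sin β * Real.cos α : ℂ) * I := by
    rw [hI, ← integral_const_mul]
    refine integral_congr_ae ?_
    filter_upwards [hs.ae_eq_boundaryDatum, hs'.ae_eq_boundaryDatum] with x hx hx'
    rw [hx.2, hx'.1, map_mul, Complex.conj_ofReal]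
    ring
  have h3 := hs.integral_trace_mul_normalDeriv hb hDm hs'
  rw [h1, h2, ← sub_eq_zero, ← sub_mul] at h3
  refine (mul_eq_zero.1 h3).resolve_left ?_
  have h4 : (Real.sin α * Real.cos β - Real.sin β * Real.cos α : ℂ) =
      ((Real.sin (α - β) : ℝ) : ℂ) := by
    rw [Real.sin_sub]
    push_cast
    ring
  rw [h4]
  exact_mod_cast hαβ

/-- A solution with vanishing Cauchy data is zero: its extension by zero solves the equation on the
whole space, so unique continuation applies. -/
theorem ae_eq_zero_of_boundaryDatum (hd : 2 ≤ d) (hD : IsOpen D) (hb : Bornology.IsBounded D)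
    (hC : HasC2Boundary D) (hv : MemLp v ∞ (volumeOn D)) (hs : IsSolution D v α E ψ G f g h)
    (hk : boundaryDatum α g h =ᵐ[surfaceMeasure D] 0) : ψ =ᵐ[volumeOn D] 0 := by
  have hg0 : g =ᵐ[surfaceMeasure D] 0 := by
    filter_upwards [hs.ae_eq_boundaryDatum, hk] with x hx hx0
    rw [hx.1, hx0]
    simp
  have hh0 : h =ᵐ[surfaceMeasure D] 0 := by
    filter_upwards [hs.ae_eq_boundaryDatum, hk] with x hx hx0
    rw [hx.2, hx0]
    simp
  refine ae_eq_zero_of_weak_laplacian_le (by omega) hb hD.measurableSet hs.sobolev.memLp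
    hs.laplacian.memLp (M := (eLpNorm v ∞ (volumeOn D)).toReal + |E|) ?_ fun φ hφ => ?_
  · have hvb : ∀ᵐ x ∂(volumeOn D), ‖v x‖ ≤ (eLpNorm v ∞ (volumeOn D)).toReal := by
      filter_upwards [enorm_ae_le_eLpNormEssSup v (volumeOn D)] with x hx
      rw [← eLpNorm_exponent_top] at hx
      simpa using ENNReal.toReal_mono hv.eLpNorm_ne_top hx
    filter_upwards [hvb, hs.equation] with x hx hx'
    have e1 : f x = ((v x - E : ℝ) : ℂ) * ψ x := by
      push_cast
      linear_combination -hx'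
    rw [e1, norm_mul, Complex.norm_real]
    gcongr
    exact (norm_sub_le _ _).trans (add_le_add hx le_rfl)
  · have hi1 : ∀ i, Integrable (fun x => G i x * partialDeriv φ i x) (volumeOn D) := fun i =>
      (hs.sobolev.memLp_grad i).integrable_mul
        (memLp_of_continuous hb (hφ.partialDeriv i).1.continuous)
    have hi0 : Integrable (fun x => f x * φ x) (volumeOn D) :=
      hs.laplacian.memLp.integrable_mul (memLp_of_continuous hb hφ.1.continuous)
    have hi2 : ∀ i, Integrable (fun x => ψ x * partialDeriv (partialDeriv φ i) i x)
        (volumeOn D) := fun i =>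
      hs.sobolev.memLp.integrable_mul
        (memLp_of_continuous hb ((hφ.partialDeriv i).partialDeriv i).1.continuous)
    have hgreen := hs.normalDeriv.green φ hφ
    have hright : ∫ x, h x * φ x ∂(surfaceMeasure D) = 0 := by
      refine integral_eq_zero_of_ae ?_
      filter_upwards [hh0] with x hx
      simp [hx]
    rw [hright, integral_add (integrable_finsetSum _ fun i _ => hi1 i) hi0,
      integral_finsetSum _ fun i _ => hi1 i] at hgreen
    simp only [Finset.mul_sum]
    rw [integral_finsetSum _ fun i _ => hi2 i]
    simp only [integral_mul_partialDeriv_of_trace_zero hd hD hb hC hs.sobolev hs.trace hg0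
      (hφ.partialDeriv _)]
    rw [Finset.sum_neg_distrib]
    linear_combination -hgreen

end IsSolution

/-! ### Countability -/

/-- In a separable inner product space, families of nonzero orthogonal vectors are countable. -/
theorem countable_of_pairwise_inner_eq_zero {H ι : Type*} [NormedAddCommGroup H]
    [InnerProductSpace ℂ H] [TopologicalSpace.SeparableSpace H] {s : Set ι} {k : ι → H}
    (hne : ∀ i ∈ s, k i ≠ 0) (h : s.Pairwise fun i j => inner ℂ (k i) (k j) = 0) :
    s.Countable := by
  set e : ι → H := fun i => ((‖k i‖⁻¹ : ℝ) : ℂ) • k i with he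
  have hnorm : ∀ i ∈ s, ‖e i‖ = 1 := fun i hi => by
    have := norm_ne_zero_iff.2 (hne i hi)
    simp [he, norm_smul, this]
  refine Set.PairwiseDisjoint.countable_of_isOpen (s := fun i => ball (e i) (1 / 2)) ?_
    (fun i _ => isOpen_ball) fun i _ => ⟨e i, mem_ball_self (by norm_num)⟩
  intro i hi j hj hij
  refine ball_disjoint_ball ?_
  have h1 : inner ℂ (e i) (e j) = 0 := by
    simp [he, h hi hj hij]
  have h2 : ‖e i - e j‖ ^ 2 = 2 := by
    rw [norm_sub_sq (𝕜 := ℂ), h1, hnorm i hi, hnorm j hj]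
    norm_num
  rw [dist_eq_norm]
  nlinarith [norm_nonneg (e i - e j)]

/-- For a fixed energy `E`, only countably many boundary conditions have `E` as an eigenvalue. -/
theorem countable_setOf_isEigenvalue {d : ℕ} (hd : 2 ≤ d) {D : Set (Space d)} (hD : IsOpen D)
    (hb : Bornology.IsBounded D) (hC : HasC2Boundary D) {v : Space d → ℝ}
    (hv : MemLp v ∞ (volumeOn D)) (E : ℝ) : {α : ℝ | IsEigenvalue D v α E}.Countable := by
  classical
  have hp : Fact ((2 : ℝ≥0∞) ≠ ⊤) := ⟨by simp⟩
  have hfin := isFiniteMeasure_surfaceMeasure hD hb hC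
  have hDm := hD.measurableSet
  have hex : ∀ α : ℝ, ∃ (ψ : Space d → ℂ) (G : Fin d → Space d → ℂ) (f g h : Space d → ℂ),
      IsEigenvalue D v α E → ¬ (ψ =ᵐ[volumeOn D] 0) ∧ IsSolution D v α E ψ G f g h := by
    intro α
    by_cases hα : IsEigenvalue D v α E
    · obtain ⟨ψ, G, f, g, h, h0, h1, h2, h3, h4, h5, h6⟩ := hα
      exact ⟨ψ, G, f, g, h, fun _ => ⟨h0, ⟨h1, h2, h3, h4, h5, h6⟩⟩⟩
    · exact ⟨0, 0, 0, 0, 0, fun h => absurd h hα⟩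
  choose ψ G f g h hsol using hex
  set κ : ℝ → Lp ℂ 2 (surfaceMeasure D) := fun α =>
    if hα : IsEigenvalue D v α E then (hsol α hα).2.memLp_boundaryDatum.toLp _ else 0 with hκ
  have hκα : ∀ α, IsEigenvalue D v α E →
      κ α =ᵐ[surfaceMeasure D] IsSolution.boundaryDatum α (g α) (h α) := by
    intro α hα
    simp only [hκ, dif_pos hα]
    exact MemLp.coeFn_toLp _
  -- Within a half-open interval of length `π`, different angles have `sin (α - β) ≠ 0`.
  have hcount : ∀ m : ℤ, {α : ℝ | IsEigenvalue D v α E ∧ ⌊α / Real.pi⌋ = m}.Countable := by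
    intro m
    refine countable_of_pairwise_inner_eq_zero (k := κ) (fun α hα h0 => ?_) fun α hα β hβ hαβ => ?_
    · obtain ⟨hψ, hs⟩ := hsol α hα.1
      refine hψ (hs.ae_eq_zero_of_boundaryDatum hd hD hb hC hv ?_)
      refine (hκα α hα.1).symm.trans ?_
      rw [h0]
      exact Lp.coeFn_zero _ _ _
    · have hsin : Real.sin (α - β) ≠ 0 := by
        intro hsin
        obtain ⟨n, hn⟩ := Real.sin_eq_zero_iff.1 hsin
        have hαd : α / Real.pi = β / Real.pi + n := by
          have := Real.pi_ne_zero
          field_simp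
          linarith
        have h1 : ⌊α / Real.pi⌋ = ⌊β / Real.pi⌋ + n := by rw [hαd, Int.floor_add_intCast]
        rw [hα.2, hβ.2] at h1
        have hn0 : n = 0 := by omega
        rw [hn0] at hn
        exact hαβ (by simpa [sub_eq_zero, eq_comm] using hn)
      change inner ℂ (κ α) (κ β) = 0
      rw [L2.inner_def, ← (hsol α hα.1).2.integral_conj_boundaryDatum_mul hb hDm
        (hsol β hβ.1).2 hsin]
      refine integral_congr_ae ?_
      filter_upwards [hκα α hα.1, hκα β hβ.1] with x hx hx'
      rw [hx, hx', RCLike.inner_apply, mul_comm]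
  refine (Set.countable_iUnion hcount).mono fun α hα => ?_
  exact Set.mem_iUnion.2 ⟨⌊α / Real.pi⌋, hα, rfl⟩

end Impedance

theorem lemma3p2 (d : ℕ) (hd : 2 ≤ d) (D : Set (Impedance.Space d))
    (hD_open : IsOpen D) (hD_bdd : Bornology.IsBounded D) (hD_C2 : Impedance.HasC2Boundary D)
    (v : Impedance.Space d → ℝ) (hv : MemLp v ∞ (Impedance.volumeOn D)) (E : ℝ) :
    {α : ℝ | Impedance.IsEigenvalue D v α E}.Countable :=
  Impedance.countable_setOf_isEigenvalue hd hD_open hD_bdd hD_C2 hv E
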